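/- Let $\mathbb X$ be a real or complex Banach space with norm $\|\cdot\|$, and let $\mathcal X=(\boldsymbol x_n)_{n\in\mathbb N}$ be a basis of $\mathbb X$: its linear span is dense and there are functionals $\boldsymbol x_n^*\in\mathbb X^*$ with $\boldsymbol x_i^*(\boldsymbol x_j)=\delta_{ij}$; assume $\sup_n\|\boldsymbol x_n\|<\infty$ and $\sup_n\|\boldsymbol x_n^*\|<\infty$. Here $\mathbb N=\{1,2,\dots\}$. Notation. For $x\in\mathbb X$, $\operatorname{supp}(x)=\{n:\boldsymbol x_n^*(x)\ne0\}$. A greedy ordering for $x$ is a sequence $\mathcal O=(k_j)_{j\in\mathbb N}$ of distinct positive integers such that for all $m\in\mathbb N$, $|\boldsymbol x_n^*(x)|\ge|\boldsymbol x_k^*(x)|$ whenever $n\in\{k_1,\dots,k_m\}$ and $k\notin\{k_1,\dots,k_m\}$. Put $$G_n^{\mathcal O}(x)=\sum_{j=1}^n\boldsymbol x_{k_j}^*(x)\boldsymbol x_{k_j},\qquad C_n^{g,\mathcal O}(x)=\sum_{j=1}^n\frac{n+1-j}{n}\,\boldsymbol x_{k_j}^*(x)\boldsymbol x_{k_j}.$$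 For $K>0$, $\mathcal X$ is $K$-de la Vallée-Poussin quasi-greedy ($K$-VPQG) if $\|2C_{2n}^{g,\mathcal O}(x)-C_n^{g,\mathcal O}(x)\|\le K\|x\|$ for all $x\in\mathbb X$, all $n\in\mathbb N$ and all greedy orderings $\mathcal O$ for $x$. For a finite set $B\subset\mathbb N$, $\operatorname{osc}(x,B)=\max_{n\in B}|\boldsymbol x_n^*(x)|\,/\,\min_{n\in B}|\boldsymbol x_n^*(x)|\in[1,\infty]$, where $b/0=\infty$ for $b\neq0$, and $\operatorname{osc}(x,B)=1$ if $B=\emptyset$ or if $\boldsymbol x_n^*(x)=0$ for all $n\in B$. Write $x\rhd y$ if $|\boldsymbol x_k^*(x)|\ge|\boldsymbol x_n^*(y)|$ for all $k\in\operatorname{supp}(x)$ and all $n\in\mathbb N$. For $t\ge0$ and $0<s\le1$, $\Psi(t,s)$ is the minimum $C\in[1,\infty]$ such that $$\Big\|\sum_{j\in\operatorname{supp}(y)}a_j\boldsymbol x_j^*(y)\boldsymbol x_j\Big\|\le C\,\|x+y+z\|$$ whenever $x,y,z\in\mathbb X$ have pairwise disjoint supports, $x\rhd y\rhd z$, $\operatorname{supp}(x)$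 and $\operatorname{supp}(y)$ are finite, $|\operatorname{supp}(x)|\le t\,|\operatorname{supp}(y)|$, $\operatorname{osc}(y,\operatorname{supp}(y))\le s^{-1}$, and $|a_j|\le1$ for all $j\in\operatorname{supp}(y)$. Lemma. Let $\mathcal X$ be $K$-VPQG, let $A\subset\mathbb N$ be nonempty, let $(n_l)_{l\in A}\subset\mathbb N$ be strictly increasing, and let $E=\{n_l+j: l\in A,\ 0\le j\le n_l\}$. Let $x\in\mathbb X$ and let $\mathcal O=(k_j)_{j\in\mathbb N}$ be a greedy ordering for $x$ such that $$M:=\sup_{l\in A}\operatorname{osc}\big(x,\{k_{n_l+1},\dots,k_{2n_l}\}\big)<\infty.$$ Then $\Psi(1,1/M)<\infty$, and for each $n\in E$, $$\|G_n^{\mathcal O}(x)\|\le\big(K+2\Psi(1,1/M)\big)\|x\|.$$ If moreover $A$ is infinite, then $\lim_{n\to\infty,\ n\in E}G_n^{\mathcal O}(x)=x$. -/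

import Mathlib

open Filter Topology
open scoped ENNReal

/-- A basis `(x_n)` of a normed space `X` over `𝕜`: a sequence with dense linear span, together with
its biorthogonal (dual) sequence `(x_n^*)` in the continuous dual, both sequences being bounded
in norm. The sequences are indexed by `ℕ` starting at `0`. -/
structure SeminormalizedBasis (𝕜 X : Type*) [RCLike 𝕜] [NormedAddCommGroup X]
    [NormedSpace 𝕜 X] where
  vec : ℕ → X
  coord : ℕ → X →L[𝕜] 𝕜
  biorthogonal : ∀ i j, coord i (vec j) = if i = j then 1 else 0
  dense_span : (Submodule.span 𝕜 (Set.range vec)).topologicalClosure = ⊤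
  bounded_vec : BddAbove (Set.range fun n => ‖vec n‖)
  bounded_coord : BddAbove (Set.range fun n => ‖coord n‖)

namespace SeminormalizedBasis

variable {𝕜 X : Type*} [RCLike 𝕜] [NormedAddCommGroup X] [NormedSpace 𝕜 X]

/-- The support `supp(x) = {n : x_n^*(x) ≠ 0}`. -/
def supp (b : SeminormalizedBasis 𝕜 X) (x : X) : Set ℕ := {n | b.coord n x ≠ 0}

/-- `A` is a greedy set for `x` of cardinality `m`. -/
def IsGreedySet (b : SeminormalizedBasis 𝕜 X) (x : X) (m : ℕ) (A : Finset ℕ) : Prop :=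
  A.card = m ∧ ∀ n ∈ A, ∀ k ∉ A, ‖b.coord k x‖ ≤ ‖b.coord n x‖

/-- `k` is a greedy ordering for `x`: for every `m`, its first `m` terms form a greedy set of
cardinality `m`. The terms `k_1, k_2, …` are `k 0, k 1, …`. -/
def IsGreedyOrdering (b : SeminormalizedBasis 𝕜 X) (x : X) (k : ℕ → ℕ) : Prop :=
  ∀ m : ℕ, b.IsGreedySet x m ((Finset.range m).image k)

/-- The greedy sum `G_n(x) = ∑_{j=1}^n x_{k_j}^*(x) x_{k_j}`. -/
def greedySum (b : SeminormalizedBasis 𝕜 X) (k : ℕ → ℕ) (n : ℕ) (x : X) : X :=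
  ∑ j ∈ Finset.range n, b.coord (k j) x • b.vec (k j)

/-- The greedy Cesàro sum `C_n(x) = ∑_{j=1}^n ((n + 1 - j) / n) x_{k_j}^*(x) x_{k_j}`
(the index `j` of this formula is `j + 1` below). -/
noncomputable def cesaroSum (b : SeminormalizedBasis 𝕜 X) (k : ℕ → ℕ) (n : ℕ) (x : X) : X :=
  ∑ j ∈ Finset.range n,
    (((n : 𝕜) + 1 - ((j : 𝕜) + 1)) / (n : 𝕜)) • (b.coord (k j) x • b.vec (k j))

/-- The basis is `K`-de la Vallée-Poussin quasi-greedy. -/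
def IsVPQG (b : SeminormalizedBasis 𝕜 X) (K : ℝ) : Prop :=
  0 < K ∧ ∀ (x : X) (k : ℕ → ℕ), b.IsGreedyOrdering x k → ∀ n : ℕ, 0 < n →
    ‖(2 : 𝕜) • b.cesaroSum k (2 * n) x - b.cesaroSum k n x‖ ≤ K * ‖x‖

open Classical in
/-- The oscillation of `x` on a finite set `A`: the quotient of the maximum of `|x_n^*(x)|` over
`n ∈ A` by the minimum, with `b / 0 = ∞` for `b ≠ 0`. It is `1` if `A` is empty, or more generally
if all the coefficients on `A` are zero. -/
noncomputable def osc (b : SeminormalizedBasis 𝕜 X) (x : X) (A : Finset ℕ) : ℝ≥0∞ :=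
  if ∀ n ∈ A, b.coord n x = 0 then 1
  else (A.sup fun n => ‖b.coord n x‖ₑ) / (A.inf fun n => ‖b.coord n x‖ₑ)

/-- The relation `x ▷ y`: `|x_k^*(x)| ≥ |x_n^*(y)|` for all `k ∈ supp(x)` and all `n`. -/
def Dominates (b : SeminormalizedBasis 𝕜 X) (x y : X) : Prop :=
  ∀ k ∈ b.supp x, ∀ n : ℕ, ‖b.coord n y‖ ≤ ‖b.coord k x‖

/-- `C` is admissible for the threshold function at `(t, s)`: `C ≥ 1`, and
`‖∑_{j ∈ supp(y)} a_j x_j^*(y) x_j‖ ≤ C ‖x + y + z‖` for all `x`, `y`, `z`, `a` subject to the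
listed conditions. Here `B` is the (finite) support of `y`. -/
def IsThresholdBound (b : SeminormalizedBasis 𝕜 X) (t s : ℝ) (C : ℝ≥0∞) : Prop :=
  1 ≤ C ∧ ∀ (x y z : X) (B : Finset ℕ) (a : ℕ → 𝕜),
    Disjoint (b.supp x) (b.supp y) → Disjoint (b.supp x) (b.supp z) →
    Disjoint (b.supp y) (b.supp z) →
    b.Dominates x y → b.Dominates y z →
    (B : Set ℕ) = b.supp y →
    (b.supp x).Finite → ((b.supp x).ncard : ℝ) ≤ t * (B.card : ℝ) →
    b.osc y B ≤ ENNReal.ofReal s⁻¹ →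
    (∀ j ∈ B, ‖a j‖ ≤ 1) →
    ‖∑ j ∈ B, a j • (b.coord j y • b.vec j)‖ₑ ≤ C * ‖x + y + z‖ₑ

/-- The threshold function `Ψ(t, s)` of the basis, for `t ≥ 0` and `0 < s ≤ 1`: the minimum of the
admissible `C ∈ [1, ∞]`. -/
noncomputable def Psi (b : SeminormalizedBasis 𝕜 X) (t s : ℝ) : ℝ≥0∞ :=
  sInf {C : ℝ≥0∞ | b.IsThresholdBound t s C}

/-- The block `{k_{m+1}, …, k_{2m}}` of an ordering. -/
def block (k : ℕ → ℕ) (m : ℕ) : Finset ℕ := (Finset.Ico m (2 * m)).image k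

end SeminormalizedBasis

/-! The de la Vallée-Poussin sum `2 C_{2N} - C_N` equals `G_N` plus the terms of the block `k_{N+1},
…, k_{2N}` with weights falling linearly from `1` to `1/N`. For `j ≤ N` its difference from
`G_{N+j}` is thus a multiplier of modulus at most `1` on that block, which is preceded by only `N`
terms, so `Ψ(1, 1/M)` controls it (`IsVPQG.norm_greedySum_le`).

The main work is the finiteness of `Ψ`. A doubling argument bounds the greedy Cesàro means. When
coefficients are tied in modulus, averaging an ordering with its reversal makes all weights equal,
so projections onto ties are bounded, and convexity upgrades this to multipliers. A top set of
oscillation close to `1` is a perturbation of a tie, and cutting at thresholds reaches any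
oscillation (`IsTopBound.sq`). A preceding set `S` of larger coefficients is removed by subtracting
a difference of Cesàro sums (`IsCesaroBound.exists_window`). This spoils only one half of the block
and leaves the other half within reach. That other half can then be enlarged and take over the role
of the spoiled one (`IsCesaroBound.exists_isBlockBound`).

For convergence, take a finite combination `u` near `x`. For `N` large, `G_{N+j}(x) - u` is a
projection of `x - u` onto largest coefficients, hence bounded by `C ‖x - u‖` with `C` independent
of `u`; density concludes. -/

namespace SeminormalizedBasis

variable {𝕜 X : Type*} [RCLike 𝕜] [NormedAddCommGroup X] [NormedSpace 𝕜 X]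

/-! ### Finite combinations of basis vectors -/

/-- The vector `∑_{j ∈ S} c_j x_j`. -/
def comb (b : SeminormalizedBasis 𝕜 X) (S : Finset ℕ) (c : ℕ → 𝕜) : X :=
  ∑ j ∈ S, c j • b.vec j

lemma coord_comb (b : SeminormalizedBasis 𝕜 X) (S : Finset ℕ) (c : ℕ → 𝕜) (i : ℕ) :
    b.coord i (b.comb S c) = if i ∈ S then c i else 0 := by
  simp [comb, map_sum, b.biorthogonal]

lemma comb_congr (b : SeminormalizedBasis 𝕜 X) {S : Finset ℕ} {c c' : ℕ → 𝕜}
    (h : ∀ j ∈ S, c j = c' j) : b.comb S c = b.comb S c' :=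
  Finset.sum_congr rfl fun j hj => by rw [h j hj]

lemma comb_union (b : SeminormalizedBasis 𝕜 X) {S T : Finset ℕ} (h : Disjoint S T) (c : ℕ → 𝕜) :
    b.comb (S ∪ T) c = b.comb S c + b.comb T c :=
  Finset.sum_union h

lemma comb_add (b : SeminormalizedBasis 𝕜 X) (S : Finset ℕ) (c c' : ℕ → 𝕜) :
    b.comb S (fun j => c j + c' j) = b.comb S c + b.comb S c' := by
  simp [comb, add_smul, Finset.sum_add_distrib]

lemma comb_sub (b : SeminormalizedBasis 𝕜 X) (S : Finset ℕ) (c c' : ℕ → 𝕜) :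
    b.comb S (fun j => c j - c' j) = b.comb S c - b.comb S c' := by
  simp [comb, sub_smul, Finset.sum_sub_distrib]

lemma comb_mul (b : SeminormalizedBasis 𝕜 X) (S : Finset ℕ) (r : 𝕜) (c : ℕ → 𝕜) :
    b.comb S (fun j => r * c j) = r • b.comb S c := by
  simp [comb, mul_smul, Finset.smul_sum]

lemma comb_eq_zero (b : SeminormalizedBasis 𝕜 X) {S : Finset ℕ} {c : ℕ → 𝕜}
    (h : ∀ j ∈ S, c j = 0) : b.comb S c = 0 :=
  Finset.sum_eq_zero fun j hj => by rw [h j hj, zero_smul]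

/-- Enlarging the index set by indices with vanishing coefficients does not change the sum. -/
lemma comb_subset (b : SeminormalizedBasis 𝕜 X) {S T : Finset ℕ} {c : ℕ → 𝕜} (hST : S ⊆ T)
    (h : ∀ j ∈ T, j ∉ S → c j = 0) : b.comb S c = b.comb T c :=
  Finset.sum_subset hST fun j hj hjS => by rw [h j hj hjS, zero_smul]

/-! ### Uniform bounds and decay of the coefficients -/

lemma exists_norm_vec_le (b : SeminormalizedBasis 𝕜 X) : ∃ c, 0 < c ∧ ∀ n, ‖b.vec n‖ ≤ c := by
  obtain ⟨c, hc⟩ := b.bounded_vec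
  exact ⟨max c 1, by positivity, fun n => (hc ⟨n, rfl⟩).trans (le_max_left _ _)⟩

lemma exists_norm_coord_le (b : SeminormalizedBasis 𝕜 X) :
    ∃ c, 0 < c ∧ ∀ n f, ‖b.coord n f‖ ≤ c * ‖f‖ := by
  obtain ⟨c, hc⟩ := b.bounded_coord
  exact ⟨max c 1, by positivity, fun n f => ((b.coord n).le_opNorm f).trans
    (mul_le_mul_of_nonneg_right ((hc ⟨n, rfl⟩).trans (le_max_left _ _)) (norm_nonneg _))⟩

/-- The one-dimensional coordinate projections are uniformly bounded. -/
lemma exists_norm_smul_le (b : SeminormalizedBasis 𝕜 X) :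
    ∃ c, 0 < c ∧ ∀ n f, ‖b.coord n f • b.vec n‖ ≤ c * ‖f‖ := by
  obtain ⟨c, hc, h⟩ := b.exists_norm_vec_le
  obtain ⟨c', hc', h'⟩ := b.exists_norm_coord_le
  refine ⟨c' * c, by positivity, fun n f => ?_⟩
  rw [norm_smul]
  calc _ ≤ (c' * ‖f‖) * c := mul_le_mul (h' n f) (h n) (norm_nonneg _) (by positivity)
    _ = _ := by ring

/-- Finite linear combinations of the basis are dense. -/
lemma exists_comb_near (b : SeminormalizedBasis 𝕜 X) (f : X) {ε : ℝ} (hε : 0 < ε) :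
    ∃ S c, ‖f - b.comb S c‖ < ε := by
  have hf : f ∈ (Submodule.span 𝕜 (Set.range b.vec)).topologicalClosure := by
    rw [b.dense_span]; trivial
  obtain ⟨u, hu, hfu⟩ := Metric.mem_closure_iff.1 hf ε hε
  obtain ⟨c, rfl⟩ := (Finsupp.mem_span_range_iff_exists_finsupp).1 hu
  exact ⟨c.support, c, by rwa [← dist_eq_norm]⟩

/-- Coefficients tend to zero: a finite combination approximates `f`, and off its index set the
coefficients of `f` are those of the error. -/
lemma finite_le_norm_coord (b : SeminormalizedBasis 𝕜 X) (f : X) {ε : ℝ} (hε : 0 < ε) :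
    {n | ε ≤ ‖b.coord n f‖}.Finite := by
  obtain ⟨c, hc, h⟩ := b.exists_norm_coord_le
  obtain ⟨S, a, hS⟩ := b.exists_comb_near f (div_pos hε hc)
  refine S.finite_toSet.subset fun n hn => ?_
  by_contra hnS
  have h1 := h n (f - b.comb S a)
  rw [map_sub, b.coord_comb, if_neg (by simpa using hnS), sub_zero] at h1
  have h2 : c * ‖f - b.comb S a‖ < ε := by
    rw [lt_div_iff₀ hc] at hS; linarith
  exact absurd (le_trans hn h1) (not_le.2 h2)

lemma exists_max_coord (b : SeminormalizedBasis 𝕜 X) (f : X) (S : Finset ℕ) :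
    ∃ n ∉ S, ∀ k ∉ S, ‖b.coord k f‖ ≤ ‖b.coord n f‖ := by
  by_cases hz : ∃ m ∉ S, b.coord m f ≠ 0
  · obtain ⟨m, hm, hm0⟩ := hz
    have hfin := (b.finite_le_norm_coord f (norm_pos_iff.2 hm0)).subset
      (Set.sep_subset _ fun n => n ∉ S)
    obtain ⟨n, hn, hmax⟩ := Set.exists_max_image _ (fun n => ‖b.coord n f‖) hfin
      ⟨m, by simpa using hm⟩
    refine ⟨n, hn.2, fun k hk => ?_⟩
    by_cases hkm : ‖b.coord m f‖ ≤ ‖b.coord k f‖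
    · exact hmax k ⟨hkm, hk⟩
    · exact (not_le.1 hkm).le.trans (hmax m ⟨le_refl ‖b.coord m f‖, hm⟩)
  · push Not at hz
    obtain ⟨n, hn⟩ := Infinite.exists_notMem_finset S
    exact ⟨n, hn, fun k hk => by simp [hz k hk]⟩

/-! ### Greedy orderings with prescribed tie-breaking -/

/-- Among the largest coefficients outside `S` there is one of least rank. -/
lemma exists_next (b : SeminormalizedBasis 𝕜 X) (f : X) (ρ : ℕ → ℕ) (S : Finset ℕ) :
    ∃ n ∉ S, (∀ k ∉ S, ‖b.coord k f‖ ≤ ‖b.coord n f‖) ∧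
      ∀ k ∉ S, ‖b.coord n f‖ ≤ ‖b.coord k f‖ → ρ n ≤ ρ k := by
  obtain ⟨m, hm, hmax⟩ := b.exists_max_coord f S
  let T : Set ℕ := {n | n ∉ S ∧ ∀ k ∉ S, ‖b.coord k f‖ ≤ ‖b.coord n f‖}
  have hT : T.Nonempty := ⟨m, hm, hmax⟩
  obtain ⟨n, hn, hmin⟩ := exists_minimalFor_of_wellFoundedLT (· ∈ T) ρ hT
  refine ⟨n, hn.1, hn.2, fun k hk hnk => ?_⟩
  by_contra hlt
  exact hlt (hmin (j := k) ⟨hk, fun l hl => (hn.2 l hl).trans hnk⟩ (not_le.1 hlt).le)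

/-- `S` consists of indices of largest coefficients of `f`. -/
def IsTop (b : SeminormalizedBasis 𝕜 X) (f : X) (S : Finset ℕ) : Prop :=
  ∀ n ∈ S, ∀ k ∉ S, ‖b.coord k f‖ ≤ ‖b.coord n f‖

/-- There are greedy orderings which break ties according to a given rank function. -/
lemma exists_greedyOrdering (b : SeminormalizedBasis 𝕜 X) (f : X) (ρ : ℕ → ℕ) :
    ∃ k : ℕ → ℕ, b.IsGreedyOrdering f k ∧ ∀ Y : Finset ℕ, b.IsTop f Y →
      (∀ n ∈ Y, ∀ m ∉ Y, ρ n < ρ m) → (Finset.range Y.card).image k = Y := by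
  choose next hnext hmax hmin using b.exists_next f ρ
  let F : ℕ → Finset ℕ := fun n => Nat.rec ∅ (fun _ S => insert (next S) S) n
  have hF : ∀ n, F (n + 1) = insert (next (F n)) (F n) := fun _ => rfl
  let k : ℕ → ℕ := fun n => next (F n)
  have hk : ∀ n, (Finset.range n).image k = F n := by
    intro n
    induction n with
    | zero => rfl
    | succ n ih => rw [Finset.range_add_one, Finset.image_insert, ih, hF]
  have hcard : ∀ n, (F n).card = n := by
    intro n
    induction n with
    | zero => rfl
    | succ n ih => rw [hF, Finset.card_insert_of_notMem (hnext _), ih]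
  have htop : ∀ n, b.IsTop f (F n) := by
    intro n
    induction n with
    | zero => intro i hi; exact absurd hi (Finset.notMem_empty i)
    | succ n ih =>
      intro i hi j hj
      rw [hF, Finset.mem_insert] at hi hj
      push Not at hj
      rcases hi with rfl | hi
      · exact hmax _ j hj.2
      · exact ih i hi j hj.2
  refine ⟨k, fun m => by rw [hk]; exact ⟨hcard m, htop m⟩, fun Y hY hρ => ?_⟩
  -- While elements of `Y` remain, the next choice lies in `Y`: any remaining element of `Y` has a
  -- coefficient at least as large as one outside, and strictly smaller rank.
  have hsub : ∀ i ≤ Y.card, F i ⊆ Y := by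
    intro i
    induction i with
    | zero => intro _; exact Finset.empty_subset Y
    | succ i ih =>
      intro hi
      rw [hF]
      refine Finset.insert_subset ?_ (ih (by omega))
      by_contra hnot
      obtain ⟨n, hn, hnF⟩ := Finset.exists_mem_notMem_of_card_lt_card
        (show (F i).card < Y.card by rw [hcard]; omega)
      exact absurd (hmin (F i) n hnF (hY n hn _ hnot)) (not_le.2 (hρ n hn _ hnot))
  rw [hk]
  exact Finset.eq_of_subset_of_card_le (hsub _ le_rfl) (by rw [hcard])

lemma IsGreedyOrdering.injective {b : SeminormalizedBasis 𝕜 X} {f : X} {k : ℕ → ℕ}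
    (hk : b.IsGreedyOrdering f k) : Function.Injective k := by
  intro i j hij
  have h := (hk (max i j + 1)).1
  have := (Finset.card_image_iff.1 (h.trans (Finset.card_range _).symm))
  exact this (by simp) (by simp) hij

/-- A chain of two sets of largest coefficients is passed by some greedy ordering. -/
lemma exists_greedyOrdering_through (b : SeminormalizedBasis 𝕜 X) {f : X} {Y Z : Finset ℕ}
    (hYZ : Y ⊆ Z) (hY : b.IsTop f Y) (hZ : b.IsTop f Z) :
    ∃ k : ℕ → ℕ, b.IsGreedyOrdering f k ∧ (Finset.range Y.card).image k = Y ∧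
      (Finset.range Z.card).image k = Z := by
  obtain ⟨k, hk, h⟩ := b.exists_greedyOrdering f
    -- Three ranks suffice: they place `Y` before its complement and `Z` before its complement in
    -- every tie.
    (fun n => if n ∈ Y then 0 else if n ∈ Z then 1 else 2)
  refine ⟨k, hk, h Y hY fun n hn m hm => ?_, h Z hZ fun n hn m hm => ?_⟩
  · rw [if_pos hn, if_neg hm]; split_ifs <;> omega
  · have hmY : m ∉ Y := fun h => hm (hYZ h)
    rw [if_neg hmY, if_neg hm]; split_ifs <;> omega

/-! ### Greedy Cesàro sums -/

/-- The sum `n C_n(f) = ∑_{m ≤ n} G_m(f)` of the first greedy sums. -/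
def cumSum (b : SeminormalizedBasis 𝕜 X) (k : ℕ → ℕ) (n : ℕ) (f : X) : X :=
  ∑ j ∈ Finset.range n, ((n : 𝕜) - j) • (b.coord (k j) f • b.vec (k j))

lemma cumSum_succ (b : SeminormalizedBasis 𝕜 X) (k : ℕ → ℕ) (n : ℕ) (f : X) :
    b.cumSum k (n + 1) f = b.cumSum k n f + b.greedySum k (n + 1) f := by
  have h : b.cumSum k n f = ∑ j ∈ Finset.range (n + 1),
      ((n : 𝕜) - j) • (b.coord (k j) f • b.vec (k j)) := by
    rw [Finset.sum_range_succ]; simp [cumSum]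
  rw [h, cumSum, greedySum, ← Finset.sum_add_distrib]
  refine Finset.sum_congr rfl fun j _ => ?_
  push_cast
  module

lemma cesaroSum_eq (b : SeminormalizedBasis 𝕜 X) (k : ℕ → ℕ) (n : ℕ) (f : X) :
    b.cesaroSum k n f = (n : 𝕜)⁻¹ • b.cumSum k n f := by
  rw [cesaroSum, cumSum, Finset.smul_sum]
  refine Finset.sum_congr rfl fun j _ => ?_
  rw [smul_smul _ _ (_ • _)]
  congr 1
  ring

/-- The de la Vallée-Poussin sum as a difference quotient of the sums `n C_n`. -/
lemma vp_eq (b : SeminormalizedBasis 𝕜 X) (k : ℕ → ℕ) (n : ℕ) (f : X) :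
    (2 : 𝕜) • b.cesaroSum k (2 * n) f - b.cesaroSum k n f =
      (n : 𝕜)⁻¹ • (b.cumSum k (2 * n) f - b.cumSum k n f) := by
  rw [cesaroSum_eq, cesaroSum_eq, smul_smul, smul_sub]
  congr 2
  push_cast
  rw [mul_inv, ← mul_assoc, mul_inv_cancel₀ two_ne_zero, one_mul]

lemma norm_greedySum_le (b : SeminormalizedBasis 𝕜 X) {c : ℝ}
    (hc : ∀ n f, ‖b.coord n f • b.vec n‖ ≤ c * ‖f‖) (k : ℕ → ℕ) (n : ℕ) (f : X) :
    ‖b.greedySum k n f‖ ≤ n * (c * ‖f‖) := by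
  refine (norm_sum_le _ _).trans ((Finset.sum_le_sum fun j _ => hc (k j) f).trans ?_)
  simp

/-- `L` bounds the greedy Cesàro means of the basis. -/
def IsCesaroBound (b : SeminormalizedBasis 𝕜 X) (L : ℝ) : Prop :=
  1 ≤ L ∧ ∀ (f : X) (k : ℕ → ℕ), b.IsGreedyOrdering f k → ∀ n : ℕ,
    ‖b.cumSum k n f‖ ≤ L * n * ‖f‖

/-- The greedy Cesàro means of a de la Vallée-Poussin quasi-greedy basis are bounded. -/
lemma IsVPQG.exists_isCesaroBound {b : SeminormalizedBasis 𝕜 X} {K : ℝ} (hK : b.IsVPQG K) :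
    ∃ L, b.IsCesaroBound L := by
  obtain ⟨c, hc, hc'⟩ := b.exists_norm_smul_le
  obtain ⟨hK0, hK⟩ := hK
  -- Passing from `r` to `2r` costs `r K ‖f‖`. For odd `n = 2r + 1` one further greedy sum is added,
  -- of norm at most `(2r + 1) c ‖f‖`, which the term `2c` absorbs.
  refine ⟨K + 2 * c + 1, by linarith, fun f k hk n => ?_⟩
  have hdouble : ∀ r : ℕ, ‖b.cumSum k (2 * r) f‖ ≤ ‖b.cumSum k r f‖ + r * (K * ‖f‖) := by
    intro r
    rcases Nat.eq_zero_or_pos r with rfl | hr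
    · simp
    have h := hK f k hk r hr
    have hr' : (0 : ℝ) < r := by exact_mod_cast hr
    rw [vp_eq, norm_smul, norm_inv, RCLike.norm_natCast, inv_mul_le_iff₀ hr'] at h
    have h2 := norm_le_norm_add_norm_sub' (b.cumSum k (2 * r) f) (b.cumSum k r f)
    linarith
  induction n using Nat.strong_induction_on with
  | _ n ih =>
    rcases Nat.eq_zero_or_pos n with rfl | hn
    · simp [cumSum]
    obtain ⟨r, hr⟩ := Nat.even_or_odd' n
    have ihr := ih r (by omega)
    have hd := hdouble r
    have hf := norm_nonneg f
    have hr0 : (0 : ℝ) ≤ r := Nat.cast_nonneg r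
    have h1 : 0 ≤ (r : ℝ) * ‖f‖ := by positivity
    have h2 : 0 ≤ c * ‖f‖ := by positivity
    have h3 : 0 ≤ c * (r * ‖f‖) := by positivity
    have h4 : 0 ≤ K * ‖f‖ := by positivity
    rcases hr with rfl | rfl
    · push_cast
      nlinarith
    · rw [cumSum_succ]
      have hg := b.norm_greedySum_le hc' k (2 * r + 1) f
      refine (norm_add_le _ _).trans ?_
      push_cast at hg ⊢
      nlinarith

/-- Differences of the sums `n C_n` are generalized de la Vallée-Poussin sums. -/
lemma cumSum_add_sub (b : SeminormalizedBasis 𝕜 X) (k : ℕ → ℕ) (p d : ℕ) (f : X) :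
    b.cumSum k (p + d) f - b.cumSum k p f = (d : 𝕜) • b.greedySum k p f +
      ∑ j ∈ Finset.range d, ((d : 𝕜) - j) • (b.coord (k (p + j)) f • b.vec (k (p + j))) := by
  rw [cumSum, cumSum, greedySum, Finset.sum_range_add, add_sub_right_comm,
    ← Finset.sum_sub_distrib, Finset.smul_sum]
  congr 1
  · refine Finset.sum_congr rfl fun j _ => ?_
    push_cast
    module
  · refine Finset.sum_congr rfl fun j _ => ?_
    push_cast
    module

lemma greedySum_eq_comb (b : SeminormalizedBasis 𝕜 X) {k : ℕ → ℕ} (hk : Function.Injective k)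
    (n : ℕ) (f : X) :
    b.greedySum k n f = b.comb ((Finset.range n).image k) fun j => b.coord j f := by
  rw [comb, Finset.sum_image hk.injOn, greedySum]

/-- With `p = |S|` and `d = |U|`, the difference of the cumulative sums at `p + d` and `p`, divided
by `d`, carries weight `1` on `S` and intermediate weights on `U`. Its norm is at most `L (2p + d) /
d` times `‖f‖`, so `U` must not be small compared with `S`. -/
lemma IsCesaroBound.exists_window {b : SeminormalizedBasis 𝕜 X} {L : ℝ} (hL : b.IsCesaroBound L)
    {f : X} {S U : Finset ℕ} (hSU : Disjoint S U) (hS : b.IsTop f S) (hT : b.IsTop f (S ∪ U))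
    (hU : U.Nonempty) {t : ℝ} (ht : (S.card : ℝ) ≤ t * U.card) :
    ∃ g : ℕ → ℝ, (∀ j ∈ U, 0 ≤ g j) ∧ (∀ j ∈ U, g j ≤ 1) ∧
      ‖b.comb S (fun j => b.coord j f) + b.comb U (fun j => (g j : 𝕜) * b.coord j f)‖ ≤
        L * (2 * t + 1) * ‖f‖ := by
  obtain ⟨k, hk, hkS, hkT⟩ := b.exists_greedyOrdering_through Finset.subset_union_left hS hT
  have hinj := hk.injective
  rw [Finset.card_union_of_disjoint hSU] at hkT
  set p := S.card
  set d := U.card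
  have hd : (0 : ℝ) < d := by exact_mod_cast hU.card_pos
  have hd' : (d : 𝕜) ≠ 0 := by exact_mod_cast hU.card_pos.ne'
  have hinj' : Function.Injective fun i => k (p + i) := fun i j h => by
    have := hinj h; omega
  have hkU : (Finset.range d).image (fun i => k (p + i)) = U := by
    refine Finset.eq_of_subset_of_card_le (fun n hn => ?_) ?_
    · obtain ⟨i, hi, rfl⟩ := Finset.mem_image.1 hn
      rw [Finset.mem_range] at hi
      have h1 : k (p + i) ∈ S ∪ U := by
        rw [← hkT]
        exact Finset.mem_image_of_mem _ (Finset.mem_range.2 (by omega))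
      refine (Finset.mem_union.1 h1).resolve_left fun h2 => ?_
      rw [← hkS] at h2
      obtain ⟨j, hj, hji⟩ := Finset.mem_image.1 h2
      have := hinj hji
      rw [Finset.mem_range] at hj
      omega
    · rw [Finset.card_image_of_injective _ hinj', Finset.card_range]
  have hinv : ∀ i, Function.invFun (fun i => k (p + i)) (k (p + i)) = i :=
    Function.leftInverse_invFun hinj'
  let g : ℕ → ℝ := fun n => ((d : ℝ) - (Function.invFun (fun i => k (p + i)) n : ℕ)) / d
  have hg : ∀ i, g (k (p + i)) = ((d : ℝ) - i) / d := fun i => by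
    change ((d : ℝ) - (Function.invFun (fun i => k (p + i)) (k (p + i)) : ℕ)) / d = _
    rw [hinv]
  refine ⟨g, fun j hj => ?_, fun j hj => ?_, ?_⟩
  · rw [← hkU] at hj
    obtain ⟨i, hi, rfl⟩ := Finset.mem_image.1 hj
    rw [hg]
    have : (i : ℝ) ≤ d := by exact_mod_cast (Finset.mem_range.1 hi).le
    exact div_nonneg (by linarith) hd.le
  · rw [← hkU] at hj
    obtain ⟨i, hi, rfl⟩ := Finset.mem_image.1 hj
    rw [hg, div_le_one hd]
    have : (0 : ℝ) ≤ i := Nat.cast_nonneg i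
    linarith
  · have key : b.comb S (fun j => b.coord j f) + b.comb U (fun j => (g j : 𝕜) * b.coord j f) =
        (d : 𝕜)⁻¹ • (b.cumSum k (p + d) f - b.cumSum k p f) := by
      rw [cumSum_add_sub, smul_add, smul_smul, inv_mul_cancel₀ hd', one_smul,
        b.greedySum_eq_comb hinj, hkS]
      congr 1
      nth_rewrite 1 [← hkU]
      rw [comb, Finset.sum_image hinj'.injOn, Finset.smul_sum]
      refine Finset.sum_congr rfl fun i _ => ?_
      rw [hg, smul_smul, smul_smul]
      congr 1
      push_cast
      field_simp
    rw [key, norm_smul, norm_inv, RCLike.norm_natCast, inv_mul_le_iff₀ hd]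
    refine (norm_sub_le _ _).trans ((add_le_add (hL.2 f k hk _) (hL.2 f k hk _)).trans ?_)
    have hL0 : 0 ≤ L * ‖f‖ := mul_nonneg (zero_le_one.trans hL.1) (norm_nonneg f)
    push_cast
    nlinarith [mul_le_mul_of_nonneg_left ht hL0]

/-! ### Coefficients of equal modulus -/

/-- Reversing a greedy ordering on an initial block of coefficients of equal size. -/
lemma IsGreedyOrdering.reverse {b : SeminormalizedBasis 𝕜 X} {f : X} {k : ℕ → ℕ}
    (hk : b.IsGreedyOrdering f k) {m : ℕ} {α : ℝ} (hα : ∀ i < m, ‖b.coord (k i) f‖ = α) :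
    b.IsGreedyOrdering f fun i => if i < m then k (m - 1 - i) else k i := by
  set k' : ℕ → ℕ := fun i => if i < m then k (m - 1 - i) else k i with hk'
  have hinj := hk.injective
  have hinj' : Function.Injective k' := by
    intro i j hij
    simp only [hk'] at hij
    split_ifs at hij <;> have := hinj hij <;> omega
  have himg : ∀ r, m ≤ r → (Finset.range r).image k' = (Finset.range r).image k := by
    intro r hr
    refine Finset.eq_of_subset_of_card_le (fun n hn => ?_) ?_
    · obtain ⟨i, hi, rfl⟩ := Finset.mem_image.1 hn
      rw [Finset.mem_range] at hi
      simp only [hk']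
      split_ifs <;> exact Finset.mem_image_of_mem _ (Finset.mem_range.2 (by omega))
    · rw [Finset.card_image_of_injective _ hinj, Finset.card_image_of_injective _ hinj']
  intro r
  refine ⟨by rw [Finset.card_image_of_injective _ hinj', Finset.card_range], ?_⟩
  rcases le_or_gt m r with hr | hr
  · rw [himg r hr]; exact (hk r).2
  · intro n hn j hj
    obtain ⟨i, hi, rfl⟩ := Finset.mem_image.1 hn
    rw [Finset.mem_range] at hi
    have h1 : ‖b.coord (k' i) f‖ = α := by
      simp only [hk']
      rw [if_pos (by omega)]
      exact hα _ (by omega)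
    rw [h1]
    by_cases hjm : j ∈ (Finset.range m).image k
    · obtain ⟨l, hl, rfl⟩ := Finset.mem_image.1 hjm
      exact (hα l (Finset.mem_range.1 hl)).le
    · rw [← hα 0 (by omega)]
      exact (hk m).2 _ (Finset.mem_image_of_mem _ (Finset.mem_range.2 (by omega))) j hjm

/-- Projections onto sets of largest coefficients of equal size are uniformly bounded. -/
lemma IsCesaroBound.norm_comb_le_of_ties {b : SeminormalizedBasis 𝕜 X} {L : ℝ}
    (hL : b.IsCesaroBound L) {f : X} {B : Finset ℕ} {α : ℝ} (hB : ∀ j ∈ B, ‖b.coord j f‖ = α)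
    (hB' : ∀ j ∉ B, ‖b.coord j f‖ ≤ α) :
    ‖b.comb B fun j => b.coord j f‖ ≤ 2 * L * ‖f‖ := by
  have htop : b.IsTop f B := fun n hn j hj => (hB' j hj).trans (hB n hn).ge
  obtain ⟨k, hk, hkB, -⟩ := b.exists_greedyOrdering_through subset_rfl htop htop
  set m := B.card
  have hkα : ∀ i < m, ‖b.coord (k i) f‖ = α := fun i hi =>
    hB _ (by rw [← hkB]; exact Finset.mem_image_of_mem _ (Finset.mem_range.2 hi))
  have hk' := hk.reverse hkα
  set k' : ℕ → ℕ := fun i => if i < m then k (m - 1 - i) else k i with hk'_def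
  -- At position `j` the two orderings contribute weights `m - j` and `j + 1`, whose sum does not
  -- depend on `j`.
  have key : b.cumSum k m f + b.cumSum k' m f =
      ((m : 𝕜) + 1) • b.comb B fun j => b.coord j f := by
    have h1 : b.cumSum k' m f =
        ∑ j ∈ Finset.range m, ((j : 𝕜) + 1) • (b.coord (k j) f • b.vec (k j)) := by
      rw [cumSum, ← Finset.sum_range_reflect]
      refine Finset.sum_congr rfl fun j hj => ?_
      rw [Finset.mem_range] at hj
      have h2 : k' (m - 1 - j) = k j := by
        simp only [hk'_def]
        rw [if_pos (by omega)]
        congr 1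
        omega
      rw [h2]
      congr 1
      rw [Nat.sub_sub, Nat.cast_sub (by omega)]
      push_cast
      ring
    rw [h1, cumSum, ← Finset.sum_add_distrib, ← hkB, ← b.greedySum_eq_comb hk.injective,
      greedySum, Finset.smul_sum]
    refine Finset.sum_congr rfl fun j _ => ?_
    module
  have hm : (0 : ℝ) < (m : ℝ) + 1 := by positivity
  have hn : ‖((m : 𝕜) + 1)‖ = (m : ℝ) + 1 := by
    have := RCLike.norm_natCast (K := 𝕜) (m + 1)
    push_cast at this
    exact this
  have h := (norm_add_le _ _).trans (add_le_add (hL.2 f k hk m) (hL.2 f k' hk' m))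
  rw [key, norm_smul, hn] at h
  have hL0 : 0 ≤ L * ‖f‖ := mul_nonneg (zero_le_one.trans hL.1) (norm_nonneg f)
  nlinarith

/-- A sum with weights in `[0, 1]` is a convex combination of subsums. -/
lemma norm_add_sum_smul_le {ι : Type*} [DecidableEq ι] (A : Finset ι) (v : ι → X) (r : ι → ℝ)
    (hr : ∀ j ∈ A, 0 ≤ r j ∧ r j ≤ 1) {C : ℝ} (w : X)
    (h : ∀ B ⊆ A, ‖w + ∑ j ∈ B, v j‖ ≤ C) : ‖w + ∑ j ∈ A, (r j : 𝕜) • v j‖ ≤ C := by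
  induction A using Finset.induction_on generalizing w with
  | empty => simpa using h ∅ subset_rfl
  | insert i A hi ih =>
    have hr' : ∀ j ∈ A, 0 ≤ r j ∧ r j ≤ 1 := fun j hj => hr j (Finset.mem_insert_of_mem hj)
    have h1 := ih hr' w fun B hB => h B (hB.trans (Finset.subset_insert _ _))
    have h2 := ih hr' (w + v i) fun B hB => by
      have := h (insert i B) (Finset.insert_subset_insert _ hB)
      rwa [Finset.sum_insert (fun hiB => hi (hB hiB)), ← add_assoc] at this
    obtain ⟨hr0, hr1⟩ := hr i (Finset.mem_insert_self _ _)
    have key : w + ∑ j ∈ insert i A, (r j : 𝕜) • v j =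
        (r i : 𝕜) • (w + v i + ∑ j ∈ A, (r j : 𝕜) • v j) +
          ((1 - r i : ℝ) : 𝕜) • (w + ∑ j ∈ A, (r j : 𝕜) • v j) := by
      rw [Finset.sum_insert hi]
      push_cast
      module
    rw [key]
    refine (norm_add_le _ _).trans ?_
    rw [norm_smul, norm_smul, RCLike.norm_ofReal, RCLike.norm_ofReal, abs_of_nonneg hr0,
      abs_of_nonneg (sub_nonneg.2 hr1)]
    nlinarith [mul_le_mul_of_nonneg_left h2 hr0,
      mul_le_mul_of_nonneg_left h1 (sub_nonneg.2 hr1)]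

/-- Constant-modulus sums dominate their multiples with weights in `[0, 1]`. -/
lemma IsCesaroBound.norm_comb_ofReal_mul_le {b : SeminormalizedBasis 𝕜 X} {L : ℝ}
    (hL : b.IsCesaroBound L) {A : Finset ℕ} {c : ℕ → 𝕜} {α : ℝ} (hα : 0 ≤ α)
    (hc : ∀ j ∈ A, ‖c j‖ = α) {r : ℕ → ℝ} (hr : ∀ j ∈ A, 0 ≤ r j ∧ r j ≤ 1) :
    ‖b.comb A fun j => (r j : 𝕜) * c j‖ ≤ 2 * L * ‖b.comb A c‖ := by
  -- Since all nonzero coefficients are tied, every subset of `A` is a set of largest coefficients.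
  have hsub : ∀ B ⊆ A, ‖b.comb B c‖ ≤ 2 * L * ‖b.comb A c‖ := by
    intro B hB
    have h := hL.norm_comb_le_of_ties (f := b.comb A c) (B := B) (α := α)
      (fun j hj => by rw [coord_comb, if_pos (hB hj), hc j (hB hj)])
      (fun j _ => by
        rw [coord_comb]
        split_ifs with hj
        · exact (hc j hj).le
        · simpa using hα)
    rwa [b.comb_congr (c' := c) fun j hj => by rw [coord_comb, if_pos (hB hj)]] at h
  have h := norm_add_sum_smul_le (𝕜 := 𝕜) A (fun j => c j • b.vec j) r hr 0
    (C := 2 * L * ‖b.comb A c‖) (fun B hB => by simpa [comb] using hsub B hB)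
  simpa [comb, mul_smul] using h

/-- The positive and negative parts of the real and imaginary parts of `a` are four weights in `[0,
1]`, each costing `2L`. -/
lemma IsCesaroBound.norm_comb_mul_le {b : SeminormalizedBasis 𝕜 X} {L : ℝ}
    (hL : b.IsCesaroBound L) {A : Finset ℕ} {c : ℕ → 𝕜} {α : ℝ} (hα : 0 ≤ α)
    (hc : ∀ j ∈ A, ‖c j‖ = α) {a : ℕ → 𝕜} (ha : ∀ j ∈ A, ‖a j‖ ≤ 1) :
    ‖b.comb A fun j => a j * c j‖ ≤ 8 * L * ‖b.comb A c‖ := by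
  have habs : ∀ s : ℝ, |s| ≤ 1 → (0 ≤ max s 0 ∧ max s 0 ≤ 1) ∧
      (0 ≤ max (-s) 0 ∧ max (-s) 0 ≤ 1) := fun s hs => by
    rw [abs_le] at hs
    refine ⟨⟨le_max_right _ _, max_le hs.2 zero_le_one⟩,
      le_max_right _ _, max_le (by linarith) zero_le_one⟩
  have hre : ∀ j ∈ A, |RCLike.re (a j)| ≤ 1 := fun j hj =>
    (RCLike.abs_re_le_norm _).trans (ha j hj)
  have him : ∀ j ∈ A, |RCLike.im (a j)| ≤ 1 := fun j hj =>
    (RCLike.abs_im_le_norm _).trans (ha j hj)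
  have h1 := hL.norm_comb_ofReal_mul_le hα hc (r := fun j => max (RCLike.re (a j)) 0)
    fun j hj => (habs _ (hre j hj)).1
  have h2 := hL.norm_comb_ofReal_mul_le hα hc (r := fun j => max (-RCLike.re (a j)) 0)
    fun j hj => (habs _ (hre j hj)).2
  have h3 := hL.norm_comb_ofReal_mul_le hα hc (r := fun j => max (RCLike.im (a j)) 0)
    fun j hj => (habs _ (him j hj)).1
  have h4 := hL.norm_comb_ofReal_mul_le hα hc (r := fun j => max (-RCLike.im (a j)) 0)
    fun j hj => (habs _ (him j hj)).2
  set v1 := b.comb A fun j => ((max (RCLike.re (a j)) 0 : ℝ) : 𝕜) * c j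
  set v2 := b.comb A fun j => ((max (-RCLike.re (a j)) 0 : ℝ) : 𝕜) * c j
  set v3 := b.comb A fun j => ((max (RCLike.im (a j)) 0 : ℝ) : 𝕜) * c j
  set v4 := b.comb A fun j => ((max (-RCLike.im (a j)) 0 : ℝ) : 𝕜) * c j
  have hs : ∀ s : ℝ, s = max s 0 - max (-s) 0 := fun s => by
    rcases le_total s 0 with h | h
    · rw [max_eq_right h, max_eq_left (by linarith)]; ring
    · rw [max_eq_left h, max_eq_right (by linarith)]; ring
  have key : (b.comb A fun j => a j * c j) = (v1 - v2) + (RCLike.I : 𝕜) • (v3 - v4) := by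
    rw [← comb_sub, ← comb_sub, ← comb_mul, ← comb_add]
    refine b.comb_congr fun j _ => ?_
    nth_rewrite 1 [← RCLike.re_add_im (a j), hs (RCLike.re (a j)), hs (RCLike.im (a j))]
    push_cast
    ring
  have hI : ‖(RCLike.I : 𝕜)‖ ≤ 1 := by
    rcases RCLike.I_mul_I_ax (K := 𝕜) with h | h
    · simp [h]
    · have h5 : ‖(RCLike.I : 𝕜)‖ * ‖(RCLike.I : 𝕜)‖ = 1 := by rw [← norm_mul, h]; simp
      nlinarith [norm_nonneg (RCLike.I : 𝕜)]
  rw [key]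
  refine (norm_add_le _ _).trans ?_
  rw [norm_smul]
  have h5 := norm_sub_le v1 v2
  have h6 := norm_sub_le v3 v4
  have h7 := mul_le_mul_of_nonneg_right hI (norm_nonneg (v3 - v4))
  linarith

/-! ### Top sets of bounded oscillation -/

/-- Arbitrary multipliers are bounded by `C` on the sets of largest coefficients whose moduli
lie between a threshold and `σ` times the threshold. -/
def IsTopBound (b : SeminormalizedBasis 𝕜 X) (σ C : ℝ) : Prop :=
  ∀ (f : X) (B : Finset ℕ) (α : ℝ), 0 ≤ α →
    (∀ j ∈ B, α ≤ ‖b.coord j f‖ ∧ ‖b.coord j f‖ ≤ σ * α) → (∀ j ∉ B, ‖b.coord j f‖ ≤ α) →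
    ∀ a : ℕ → 𝕜, (∀ j ∈ B, ‖a j‖ ≤ 1) → ‖b.comb B fun j => a j * b.coord j f‖ ≤ C * ‖f‖

/-- Flattening the coefficients on `B` to modulus `α` changes `f` by `δ w`, and `w` is itself
controlled by the flattened sum. For this `δ` the resulting term is half of that sum and is absorbed
on the left; multipliers then act on the flattened sum. -/
lemma IsCesaroBound.isTopBound {b : SeminormalizedBasis 𝕜 X} {L : ℝ}
    (hL : b.IsCesaroBound L) : b.IsTopBound (1 + 1 / (8 * L ^ 2)) (64 * L ^ 2) := by
  intro f B α hα hB hB' a ha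
  have hL1 := hL.1
  set δ := 1 / (8 * L ^ 2) with hδ
  have hδ0 : 0 < δ := by positivity
  have hδL : δ * (8 * L ^ 2) = 1 := by rw [hδ]; field_simp
  have hδ1 : δ ≤ 1 := by nlinarith
  rcases hα.eq_or_lt with rfl | hα
  · rw [b.comb_eq_zero fun j hj => by
      have := (hB j hj).2
      rw [mul_zero, norm_le_zero_iff] at this
      rw [this, mul_zero]]
    simp only [norm_zero]
    positivity
  let e : ℕ → 𝕜 := fun j => ((α / ‖b.coord j f‖ : ℝ) : 𝕜) * b.coord j f
  have hpos : ∀ j ∈ B, 0 < ‖b.coord j f‖ := fun j hj => hα.trans_le (hB j hj).1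
  have he : ∀ j ∈ B, ‖e j‖ = α := fun j hj => by
    have := (hpos j hj).ne'
    simp only [e]
    rw [norm_mul, RCLike.norm_ofReal, abs_of_nonneg (by positivity)]
    field_simp
  let q : ℕ → ℝ := fun j => ‖b.coord j f‖ / α
  have hq : ∀ j ∈ B, 1 ≤ q j ∧ q j ≤ 1 + δ := fun j hj =>
    ⟨(one_le_div hα).2 (hB j hj).1, (div_le_iff₀ hα).2 (hB j hj).2⟩
  have hqe : ∀ j ∈ B, b.coord j f = (q j : 𝕜) * e j := fun j hj => by
    have h1 := (hpos j hj).ne'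
    simp only [e, q]
    rw [← mul_assoc, ← RCLike.ofReal_mul, div_mul_div_cancel₀ hα.ne', div_self h1]
    simp
  let w := b.comb B fun j => (((q j - 1) / δ : ℝ) : 𝕜) * e j
  have hw : ‖w‖ ≤ 2 * L * ‖b.comb B e‖ := by
    refine hL.norm_comb_ofReal_mul_le hα.le he fun j hj => ⟨?_, ?_⟩
    · exact div_nonneg (by linarith [(hq j hj).1]) hδ0.le
    · rw [div_le_one hδ0]; linarith [(hq j hj).2]
  have hcoord : ∀ j, b.coord j (f - (δ : 𝕜) • w) = if j ∈ B then e j else b.coord j f := by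
    intro j
    rw [map_sub, map_smul, coord_comb]
    split_ifs with hj
    · rw [smul_eq_mul, ← mul_assoc, ← RCLike.ofReal_mul, mul_div_cancel₀ _ hδ0.ne', hqe j hj]
      push_cast
      ring
    · simp
  have hties := hL.norm_comb_le_of_ties (f := f - (δ : 𝕜) • w) (B := B) (α := α)
    (fun j hj => by rw [hcoord, if_pos hj, he j hj])
    (fun j hj => by rw [hcoord, if_neg hj]; exact hB' j hj)
  rw [b.comb_congr (c' := e) fun j hj => by rw [hcoord, if_pos hj]] at hties
  have hsub : ‖f - (δ : 𝕜) • w‖ ≤ ‖f‖ + δ * ‖w‖ := by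
    refine (norm_sub_le _ _).trans ?_
    rw [norm_smul, RCLike.norm_ofReal, abs_of_pos hδ0]
  have hfin : ‖b.comb B e‖ ≤ 4 * L * ‖f‖ := by
    have h1 : 2 * L * ‖f - (δ : 𝕜) • w‖ ≤ 2 * L * (‖f‖ + δ * (2 * L * ‖b.comb B e‖)) := by
      gcongr
      exact hsub.trans (by gcongr)
    have h2 : 2 * L * (‖f‖ + δ * (2 * L * ‖b.comb B e‖)) =
        2 * L * ‖f‖ + (δ * (8 * L ^ 2)) / 2 * ‖b.comb B e‖ := by ring
    rw [h2, hδL] at h1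
    linarith
  have hmul := hL.norm_comb_mul_le hα.le he (a := fun j => a j * ((q j / (1 + δ) : ℝ) : 𝕜))
    fun j hj => by
      rw [norm_mul, RCLike.norm_ofReal, abs_of_nonneg
        (div_nonneg (by linarith [(hq j hj).1]) (by linarith))]
      exact mul_le_one₀ (ha j hj) (div_nonneg (by linarith [(hq j hj).1]) (by linarith))
        ((div_le_one (by linarith)).2 (hq j hj).2)
  have hscale : (b.comb B fun j => a j * b.coord j f) =
      ((1 + δ : ℝ) : 𝕜) • b.comb B fun j => a j * ((q j / (1 + δ) : ℝ) : 𝕜) * e j := by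
    rw [← comb_mul]
    refine b.comb_congr fun j hj => ?_
    have h1 : ((1 + δ : ℝ) : 𝕜) * ((q j / (1 + δ) : ℝ) : 𝕜) = q j := by
      rw [← RCLike.ofReal_mul, mul_div_cancel₀ _ (by linarith : 1 + δ ≠ 0)]
    rw [hqe j hj, ← h1]
    ring
  rw [hscale, norm_smul, RCLike.norm_ofReal, abs_of_pos (by linarith)]
  calc _ ≤ 2 * (8 * L * (4 * L * ‖f‖)) := by
        gcongr
        · linarith
        · exact hmul.trans (by gcongr)
    _ = _ := by ring

lemma IsTopBound.mono {b : SeminormalizedBasis 𝕜 X} {σ σ' C : ℝ} (h : b.IsTopBound σ C)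
    (hσ : σ' ≤ σ) : b.IsTopBound σ' C := fun f B α hα hB hB' a ha =>
  h f B α hα (fun j hj => ⟨(hB j hj).1, (hB j hj).2.trans (by gcongr)⟩) hB' a ha

/-- Cut `B` at level `σ α`. The upper part is a top set of `f` with oscillation at most `σ`; once it
is subtracted, so is the lower part for the remainder. -/
lemma IsTopBound.sq {b : SeminormalizedBasis 𝕜 X} {σ C : ℝ} (h : b.IsTopBound σ C)
    (hσ : 1 ≤ σ) (hC : 0 ≤ C) : b.IsTopBound (σ ^ 2) (C + C * (1 + C)) := by
  classical
  intro f B α hα hB hB' a ha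
  let B₁ := B.filter fun j => σ * α < ‖b.coord j f‖
  let B₂ := B.filter fun j => ¬ σ * α < ‖b.coord j f‖
  have hασ : α ≤ σ * α := le_mul_of_one_le_left hα hσ
  have htop : ∀ c : ℕ → 𝕜, (∀ j ∈ B₁, ‖c j‖ ≤ 1) →
      ‖b.comb B₁ fun j => c j * b.coord j f‖ ≤ C * ‖f‖ := by
    refine h f B₁ (σ * α) (hα.trans hασ) (fun j hj => ?_) fun j hj => ?_
    · obtain ⟨hjB, hj⟩ := Finset.mem_filter.1 hj
      exact ⟨hj.le, (hB j hjB).2.trans_eq (by ring)⟩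
    · by_cases hjB : j ∈ B
      · exact not_lt.1 fun hlt => hj (Finset.mem_filter.2 ⟨hjB, hlt⟩)
      · exact (hB' j hjB).trans hασ
  have h1 := htop a fun j hj => ha j (Finset.mem_filter.1 hj).1
  have h2 := htop (fun _ => 1) fun j _ => by simp
  simp only [one_mul] at h2
  set f' := f - b.comb B₁ fun j => b.coord j f with hf'
  have hcoord : ∀ j, b.coord j f' = if j ∈ B₁ then 0 else b.coord j f := by
    intro j
    rw [hf', map_sub, coord_comb]
    split_ifs <;> simp
  have hB₂ : ∀ j ∈ B₂, b.coord j f' = b.coord j f := fun j hj => by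
    have hj' : j ∉ B₁ := fun hj' => (Finset.mem_filter.1 hj).2 (Finset.mem_filter.1 hj').2
    rw [hcoord, if_neg hj']
  have h3 := h f' B₂ α hα (fun j hj => by
      rw [hB₂ j hj]
      obtain ⟨hjB, hj⟩ := Finset.mem_filter.1 hj
      exact ⟨(hB j hjB).1, not_lt.1 hj⟩)
    (fun j hj => by
      rw [hcoord]
      split_ifs with hj1
      · simpa using hα
      · exact hB' j fun hjB => by
          by_cases hlt : σ * α < ‖b.coord j f‖
          · exact hj1 (Finset.mem_filter.2 ⟨hjB, hlt⟩)
          · exact hj (Finset.mem_filter.2 ⟨hjB, hlt⟩))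
    a fun j hj => ha j (Finset.mem_filter.1 hj).1
  rw [b.comb_congr (c' := fun j => a j * b.coord j f) fun j hj => by rw [hB₂ j hj]] at h3
  have hf'n : ‖f'‖ ≤ (1 + C) * ‖f‖ := (norm_sub_le _ _).trans (by linarith)
  have hsplit : (b.comb B fun j => a j * b.coord j f) =
      (b.comb B₁ fun j => a j * b.coord j f) + b.comb B₂ fun j => a j * b.coord j f :=
    (Finset.sum_filter_add_sum_filter_not B _ _).symm
  rw [hsplit]
  refine (norm_add_le _ _).trans ?_
  have h4 := mul_le_mul_of_nonneg_left hf'n hC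
  linarith

lemma IsCesaroBound.exists_isTopBound {b : SeminormalizedBasis 𝕜 X} {L : ℝ}
    (hL : b.IsCesaroBound L) (σ : ℝ) : ∃ C, 0 ≤ C ∧ b.IsTopBound σ C := by
  have hL1 := hL.1
  set τ := 1 + 1 / (8 * L ^ 2) with hτ
  have hτ1 : 1 < τ := by rw [hτ]; exact lt_add_of_pos_right _ (by positivity)
  have hpow : ∀ m : ℕ, ∃ C, 0 ≤ C ∧ b.IsTopBound (τ ^ 2 ^ m) C := by
    intro m
    induction m with
    | zero => exact ⟨64 * L ^ 2, by positivity, by rw [pow_zero, pow_one]; exact hL.isTopBound⟩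
    | succ m ih =>
      obtain ⟨C, hC, h⟩ := ih
      refine ⟨C + C * (1 + C), by positivity, ?_⟩
      rw [pow_succ, pow_mul]
      exact h.sq (one_le_pow₀ hτ1.le) hC
  obtain ⟨m, hm⟩ := pow_unbounded_of_one_lt σ hτ1
  obtain ⟨C, hC, h⟩ := hpow m
  -- The exponent `m` already gives `σ < τ ^ m`, and `m ≤ 2 ^ m`.
  exact ⟨C, hC, h.mono (hm.le.trans (pow_le_pow_right₀ hτ1.le (Nat.lt_two_pow_self).le))⟩

/-! ### Blocks preceded by larger coefficients -/

/-- If `S`, `U`, `D` are consecutive blocks of a greedy ordering, with `U` not much smaller than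
`S`, then the multipliers supported on the last block are bounded. -/
lemma IsCesaroBound.norm_comb_last_le {b : SeminormalizedBasis 𝕜 X} {L σ C t : ℝ}
    (hL : b.IsCesaroBound L) (hC : 0 ≤ C) (h : b.IsTopBound σ C) {f : X} {S U D : Finset ℕ}
    (hSU : Disjoint S U) (hSD : Disjoint S D) (hUD : Disjoint U D) (hS : b.IsTop f S)
    (hT : b.IsTop f (S ∪ U)) (hU : U.Nonempty) (ht : (S.card : ℝ) ≤ t * U.card)
    {α : ℝ} (hα : 0 ≤ α)
    (hUα : ∀ j ∈ U, ‖b.coord j f‖ ≤ σ * α)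
    (hDα : ∀ j ∈ D, α ≤ ‖b.coord j f‖ ∧ ‖b.coord j f‖ ≤ σ * α)
    (hout : ∀ j, j ∉ S → j ∉ U → j ∉ D → ‖b.coord j f‖ ≤ α)
    {a : ℕ → 𝕜} (ha : ∀ j ∈ D, ‖a j‖ ≤ 1) :
    ‖b.comb D fun j => a j * b.coord j f‖ ≤ C * (1 + L * (2 * t + 1)) * ‖f‖ := by
  classical
  obtain ⟨g, hg0, hg1, hg⟩ := hL.exists_window hSU hS hT hU ht
  set f₁ := f - (b.comb S (fun j => b.coord j f) +
    b.comb U (fun j => (g j : 𝕜) * b.coord j f)) with hf₁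
  have hcS : ∀ j ∈ S, b.coord j f₁ = 0 := fun j hj => by
    rw [hf₁, map_sub, map_add, coord_comb, coord_comb, if_pos hj,
      if_neg (Finset.disjoint_left.1 hSU hj)]
    simp
  have hcU : ∀ j ∈ U, b.coord j f₁ = ((1 - g j : ℝ) : 𝕜) * b.coord j f := fun j hj => by
    rw [hf₁, map_sub, map_add, coord_comb, coord_comb, if_pos hj,
      if_neg (Finset.disjoint_right.1 hSU hj)]
    push_cast
    ring
  have hcO : ∀ j, j ∉ S → j ∉ U → b.coord j f₁ = b.coord j f := fun j hj hj' => by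
    rw [hf₁, map_sub, map_add, coord_comb, coord_comb, if_neg hj, if_neg hj']
    simp
  have hcD : ∀ j ∈ D, b.coord j f₁ = b.coord j f := fun j hj =>
    hcO j (Finset.disjoint_right.1 hSD hj) (Finset.disjoint_right.1 hUD hj)
  -- Subtracting the window annihilates `S` and shrinks the coefficients on `U`. Those still at
  -- least `α` must join `D` to form a top set of `f₁`; the multiplier vanishes on them.
  let V := U.filter fun j => α ≤ ‖b.coord j f₁‖
  have hVD : ∀ j ∈ V, j ∉ D := fun j hj =>
    Finset.disjoint_left.1 hUD (Finset.mem_filter.1 hj).1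
  have hmain := h f₁ (D ∪ V) α hα (fun j hj => by
      rcases Finset.mem_union.1 hj with hj | hj
      · rw [hcD j hj]; exact hDα j hj
      · obtain ⟨hjU, hj⟩ := Finset.mem_filter.1 hj
        refine ⟨hj, le_trans ?_ (hUα j hjU)⟩
        rw [hcU j hjU, norm_mul, RCLike.norm_ofReal,
          abs_of_nonneg (sub_nonneg.2 (hg1 j hjU))]
        exact mul_le_of_le_one_left (norm_nonneg _) (by linarith [hg0 j hjU]))
    (fun j hj => by
      rw [Finset.mem_union, not_or] at hj
      by_cases hjS : j ∈ S
      · rw [hcS j hjS, norm_zero]; exact hα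
      by_cases hjU : j ∈ U
      · by_contra hlt
        exact hj.2 (Finset.mem_filter.2 ⟨hjU, (not_le.1 hlt).le⟩)
      · rw [hcO j hjS hjU]
        exact hout j hjS hjU hj.1)
    (fun j => if j ∈ D then a j else 0)
    (fun j _ => by
      split_ifs with hj
      · exact ha j hj
      · simp)
  rw [← b.comb_subset (S := D) Finset.subset_union_left (fun j _ hj => by simp [hj]),
    b.comb_congr (c' := fun j => a j * b.coord j f)
      fun j hj => by rw [if_pos hj, hcD j hj]] at hmain
  calc _ ≤ C * ‖f₁‖ := hmain
    _ ≤ C * (‖f‖ + L * (2 * t + 1) * ‖f‖) := by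
      gcongr
      exact (norm_sub_le _ _).trans (by gcongr)
    _ = _ := by ring

/-- Multipliers supported on a block `B` following a set `S` with at most `t |B|` elements in a
greedy ordering, on which the moduli of the coefficients lie between a threshold and `σ` times
the threshold, are bounded by `C`. -/
def IsBlockBound (b : SeminormalizedBasis 𝕜 X) (t σ C : ℝ) : Prop :=
  ∀ (f : X) (S B : Finset ℕ) (α : ℝ), 0 ≤ α → Disjoint S B → b.IsTop f S →
    (S.card : ℝ) ≤ t * B.card → (∀ j ∈ B, α ≤ ‖b.coord j f‖ ∧ ‖b.coord j f‖ ≤ σ * α) →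
    (∀ j, j ∉ S → j ∉ B → ‖b.coord j f‖ ≤ α) →
    ∀ a : ℕ → 𝕜, (∀ j ∈ B, ‖a j‖ ≤ 1) → ‖b.comb B fun j => a j * b.coord j f‖ ≤ C * ‖f‖

/-- Split `B` into halves `U`, `D` with `U` first in a greedy ordering. The window on `U` bounds
multipliers on `D`. In particular `D` can be raised to the largest modulus in `B` at bounded cost;
then `D` precedes `U`, and the window on `D` bounds multipliers on `U`. -/
lemma IsCesaroBound.exists_isBlockBound {b : SeminormalizedBasis 𝕜 X} {L : ℝ}
    (hL : b.IsCesaroBound L) {t : ℝ} (ht : 0 ≤ t) {σ : ℝ} (hσ : 0 ≤ σ) :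
    ∃ C, 0 ≤ C ∧ b.IsBlockBound t σ C := by
  classical
  obtain ⟨C, hC, h⟩ := hL.exists_isTopBound σ
  obtain ⟨c, hc, hc'⟩ := b.exists_norm_smul_le
  have hL0 : 0 ≤ L := zero_le_one.trans hL.1
  -- The factor `3` arises because `m ≤ 3 ⌊m/2⌋` for `m ≥ 2`, so each half has at least a third of
  -- the elements of `B`; a block with at most one element is left to the coordinate projections.
  set C₁ := C * (1 + L * (2 * (3 * t) + 1)) with hC₁
  have hC₁0 : 0 ≤ C₁ := by positivity
  refine ⟨c + (C₁ + C₁ * (1 + σ * C₁)), by positivity, ?_⟩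
  intro f S B α hα hSB hS hcard hB hout a ha
  have hrest : 0 ≤ (C₁ + C₁ * (1 + σ * C₁)) * ‖f‖ := by positivity
  have hc0 : 0 ≤ c * ‖f‖ := by positivity
  rw [add_mul]
  rcases hα.eq_or_lt with rfl | hα
  · rw [b.comb_eq_zero fun j hj => by
      have := (hB j hj).2
      rw [mul_zero, norm_le_zero_iff] at this
      rw [this, mul_zero], norm_zero]
    linarith
  rcases Nat.lt_or_ge B.card 2 with hB1 | hB2
  · have hB1' : (B.card : ℝ) ≤ 1 := by exact_mod_cast Nat.lt_succ_iff.1 hB1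
    have : ‖b.comb B fun j => a j * b.coord j f‖ ≤ B.card * (c * ‖f‖) := by
      refine (norm_sum_le _ _).trans ((Finset.sum_le_sum fun j hj => ?_).trans
        (by rw [Finset.sum_const, nsmul_eq_mul]))
      rw [mul_smul, norm_smul]
      exact (mul_le_of_le_one_left (norm_nonneg _) (ha j hj)).trans (hc' j f)
    nlinarith
  set m := B.card with hm
  have hT : b.IsTop f (S ∪ B) := by
    intro n hn k hk
    rw [Finset.mem_union, not_or] at hk
    rcases Finset.mem_union.1 hn with hn | hn
    · exact hS n hn k hk.1
    · exact (hout k hk.1 hk.2).trans (hB n hn).1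
  obtain ⟨k, hk, hkS, hkT⟩ := b.exists_greedyOrdering_through Finset.subset_union_left hS hT
  rw [Finset.card_union_of_disjoint hSB] at hkT
  set p := S.card with hp
  set d := m - m / 2 with hd
  set Y := (Finset.range (p + d)).image k with hY
  have hSY : S ⊆ Y := by
    rw [← hkS]; exact Finset.image_subset_image (Finset.range_subset_range.2 (by omega))
  have hYT : Y ⊆ S ∪ B := by
    rw [← hkT]; exact Finset.image_subset_image (Finset.range_subset_range.2 (by omega))
  have hYtop := hk (p + d)
  set U := Y \ S with hU
  set D := B \ U with hD
  have hSU : Disjoint S U := Finset.disjoint_sdiff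
  have hUD : Disjoint U D := Finset.disjoint_sdiff
  have hUB : U ⊆ B := fun j hj => by
    rw [hU, Finset.mem_sdiff] at hj
    exact (Finset.mem_union.1 (hYT hj.1)).resolve_left hj.2
  have hDB : D ⊆ B := Finset.sdiff_subset
  have hSD : Disjoint S D := hSB.mono_right hDB
  have hSUY : S ∪ U = Y := Finset.union_sdiff_of_subset hSY
  have hUD' : U ∪ D = B := Finset.union_sdiff_of_subset hUB
  have hUcard : U.card = d := by
    rw [hU, Finset.card_sdiff_of_subset hSY, hYtop.1]; omega
  have hDcard : D.card = m / 2 := by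
    rw [hD, Finset.card_sdiff_of_subset hUB, hUcard]; omega
  have hcardle : ∀ q : ℕ, m ≤ 3 * q → (p : ℝ) ≤ 3 * t * q := fun q hq => by
    have : (m : ℝ) ≤ 3 * q := by exact_mod_cast hq
    nlinarith
  have hboundD : ∀ a : ℕ → 𝕜, (∀ j ∈ D, ‖a j‖ ≤ 1) →
      ‖b.comb D fun j => a j * b.coord j f‖ ≤ C₁ * ‖f‖ := fun a ha =>
    hL.norm_comb_last_le hC h hSU hSD hUD hS (by rw [hSUY]; exact hYtop.2)
      (Finset.card_pos.1 (by omega)) (by rw [hUcard]; exact hcardle _ (by omega)) hα.le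
      (fun j hj => (hB j (hUB hj)).2) (fun j hj => hB j (hDB hj))
      (fun j hjS hjU hjD => hout j hjS fun hjB => by
        rw [← hUD', Finset.mem_union] at hjB
        exact hjB.elim hjU hjD) ha
  have hBne : B.Nonempty := Finset.card_pos.1 (by omega)
  obtain ⟨i, hi, hmax⟩ := B.exists_max_image (fun j => ‖b.coord j f‖) hBne
  set μ := ‖b.coord i f‖ with hμ
  have hμα := hB i hi
  have hσ0 : 0 < σ := by
    by_contra hneg
    have : σ * α ≤ 0 := mul_nonpos_of_nonpos_of_nonneg (not_lt.1 hneg) hα.le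
    linarith
  have hpos : ∀ j ∈ B, 0 < ‖b.coord j f‖ := fun j hj => hα.trans_le (hB j hj).1
  -- Raising `D` to modulus `μ` multiplies each coefficient by a factor in `[1, σ]`; the increment
  -- is divided by `σ` to be an admissible multiplier.
  have hraise := hboundD (fun j => (((μ / ‖b.coord j f‖ - 1) / σ : ℝ) : 𝕜)) fun j hj => by
    have hj := hDB hj
    have h1 : 1 ≤ μ / ‖b.coord j f‖ := (one_le_div (hpos j hj)).2 (hmax j hj)
    have h2 : μ / ‖b.coord j f‖ ≤ σ := by
      rw [div_le_iff₀ (hpos j hj)]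
      exact hμα.2.trans (by gcongr; exact (hB j hj).1)
    rw [RCLike.norm_ofReal, abs_of_nonneg (div_nonneg (by linarith) hσ0.le), div_le_one hσ0]
    linarith
  set w := b.comb D fun j => (((μ / ‖b.coord j f‖ - 1) / σ : ℝ) : 𝕜) * b.coord j f
  set f' := f + (σ : 𝕜) • w with hf'
  have hcD : ∀ j ∈ D, ‖b.coord j f'‖ = μ := fun j hj => by
    have h1 := hpos j (hDB hj)
    have h2 : b.coord j f' = ((μ / ‖b.coord j f‖ : ℝ) : 𝕜) * b.coord j f := by
      rw [hf', map_add, map_smul, coord_comb, if_pos hj, smul_eq_mul, ← mul_assoc,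
        ← RCLike.ofReal_mul, mul_div_cancel₀ _ hσ0.ne']
      push_cast
      ring
    rw [h2, norm_mul, RCLike.norm_ofReal, abs_of_nonneg (by positivity),
      div_mul_cancel₀ _ h1.ne']
  have hcO : ∀ j ∉ D, b.coord j f' = b.coord j f := fun j hj => by
    rw [hf', map_add, map_smul, coord_comb, if_neg hj]
    simp
  have hiS : i ∉ S := Finset.disjoint_right.1 hSB hi
  have hS' : ∀ n ∈ S, ∀ j ∉ S, ‖b.coord j f'‖ ≤ ‖b.coord n f'‖ := by
    intro n hn j hj
    rw [hcO n (Finset.disjoint_left.1 hSD hn)]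
    by_cases hjD : j ∈ D
    · rw [hcD j hjD]; exact hS n hn i hiS
    · rw [hcO j hjD]; exact hS n hn j hj
  have hSD' : b.IsTop f' (S ∪ D) := by
    intro n hn j hj
    rw [Finset.mem_union, not_or] at hj
    rcases Finset.mem_union.1 hn with hn | hn
    · exact hS' n hn j hj.1
    · rw [hcD n hn, hcO j hj.2]
      by_cases hjB : j ∈ B
      · exact hmax j hjB
      · exact (hout j hj.1 hjB).trans hμα.1
  have hcU : ∀ j ∈ U, b.coord j f' = b.coord j f := fun j hj =>
    hcO j (Finset.disjoint_left.1 hUD hj)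
  have hboundU := hL.norm_comb_last_le hC h (f := f') (t := 3 * t) hSD hSU hUD.symm hS' hSD'
    (Finset.card_pos.1 (by omega)) (by rw [hDcard]; exact hcardle _ (by omega)) hα.le
    (fun j hj => by rw [hcD j hj]; exact hμα.2)
    (fun j hj => by rw [hcU j hj]; exact hB j (hUB hj))
    (fun j hjS hjD hjU => by
      rw [hcO j hjD]
      refine hout j hjS fun hjB => ?_
      rw [← hUD', Finset.mem_union] at hjB
      exact hjB.elim hjU hjD)
    (a := a) fun j hj => ha j (hUB hj)
  rw [b.comb_congr (c' := fun j => a j * b.coord j f) fun j hj => by rw [hcU j hj]] at hboundU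
  have hf'n : ‖f'‖ ≤ (1 + σ * C₁) * ‖f‖ := by
    refine (norm_add_le _ _).trans ?_
    rw [norm_smul, RCLike.norm_ofReal, abs_of_pos hσ0]
    have := mul_le_mul_of_nonneg_left hraise hσ
    linarith
  have hDa := hboundD a fun j hj => ha j (hDB hj)
  rw [← hUD', b.comb_union hUD]
  have h1 := norm_add_le (b.comb U fun j => a j * b.coord j f)
    (b.comb D fun j => a j * b.coord j f)
  have h2 := mul_le_mul_of_nonneg_left hf'n hC₁0
  linarith

/-! ### Finiteness of the threshold function -/

lemma norm_coord_le_of_osc_le (b : SeminormalizedBasis 𝕜 X) {f : X} {B : Finset ℕ} {σ : ℝ}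
    (hσ : 0 ≤ σ) (h : b.osc f B ≤ ENNReal.ofReal σ) {i j : ℕ} (hi : i ∈ B) (hj : j ∈ B) :
    ‖b.coord i f‖ ≤ σ * ‖b.coord j f‖ := by
  rw [osc] at h
  split_ifs at h with hz
  · rw [hz i hi, norm_zero]; positivity
  · have hinf : B.inf (fun n => ‖b.coord n f‖ₑ) ≤ ‖b.coord j f‖ₑ := Finset.inf_le hj
    rw [ENNReal.div_le_iff_le_mul (Or.inr ENNReal.ofReal_ne_top)
      (Or.inl (hinf.trans_lt enorm_lt_top).ne)] at h
    have h1 : ‖b.coord i f‖ₑ ≤ ENNReal.ofReal σ * ‖b.coord j f‖ₑ :=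
      (Finset.le_sup (f := fun n => ‖b.coord n f‖ₑ) hi).trans (h.trans (by gcongr))
    rwa [← ofReal_norm, ← ofReal_norm, ← ENNReal.ofReal_mul hσ,
      ENNReal.ofReal_le_ofReal_iff (by positivity)] at h1

/-- Take `S = supp x` and, as threshold, the least modulus of a coefficient of `y` on its support;
the two domination relations order the coefficients of `x + y + z` as required. -/
lemma IsBlockBound.isThresholdBound {b : SeminormalizedBasis 𝕜 X} {t σ C : ℝ}
    (h : b.IsBlockBound t σ C) (hσ : 0 ≤ σ) (hC : 0 ≤ C) :
    b.IsThresholdBound t σ⁻¹ (max 1 (ENNReal.ofReal C)) := by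
  refine ⟨le_max_left _ _, ?_⟩
  intro x y z B a hxy hxz hyz dxy dyz hB hfin hcard hosc ha
  rw [inv_inv] at hosc
  rcases B.eq_empty_or_nonempty with rfl | hBne
  · simp
  have hmemB : ∀ j, j ∈ B ↔ b.coord j y ≠ 0 := fun j => by
    rw [← Finset.mem_coe, hB]; rfl
  have h0 : ∀ {u v : X}, Disjoint (b.supp u) (b.supp v) → ∀ j, b.coord j u ≠ 0 →
      b.coord j v = 0 := fun hd j hj => by
    by_contra hne
    exact Set.disjoint_left.1 hd hj hne
  set f := x + y + z with hf
  have hfj : ∀ j, b.coord j f = b.coord j x + b.coord j y + b.coord j z := fun j => by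
    rw [hf, map_add, map_add]
  set S := hfin.toFinset with hS
  have hmemS : ∀ j, j ∈ S ↔ b.coord j x ≠ 0 := fun j => by rw [hS, Set.Finite.mem_toFinset]; rfl
  have hfS : ∀ j ∈ S, b.coord j f = b.coord j x := fun j hj => by
    rw [hfj, h0 hxy j ((hmemS j).1 hj), h0 hxz j ((hmemS j).1 hj)]
    simp
  have hfB : ∀ j ∈ B, b.coord j f = b.coord j y := fun j hj => by
    rw [hfj, h0 hxy.symm j ((hmemB j).1 hj), h0 hyz j ((hmemB j).1 hj)]
    simp
  have hfO : ∀ j, j ∉ S → j ∉ B → b.coord j f = b.coord j z := fun j hjS hjB => by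
    rw [hmemS, not_not] at hjS
    rw [hmemB, not_not] at hjB
    rw [hfj, hjS, hjB]
    simp
  obtain ⟨i, hi, hmin⟩ := B.exists_min_image (fun j => ‖b.coord j y‖) hBne
  have hdisj : Disjoint S B := Finset.disjoint_left.2 fun j hjS hjB =>
    (hmemB j).1 hjB (h0 hxy j ((hmemS j).1 hjS))
  have hmain := h f S B ‖b.coord i y‖ (norm_nonneg _) hdisj
    (fun n hn j hj => by
      rw [hfS n hn]
      by_cases hjB : j ∈ B
      · rw [hfB j hjB]; exact dxy n ((hmemS n).1 hn) j
      · rw [hfO j hj hjB]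
        exact (dyz i ((hmemB i).1 hi) j).trans (dxy n ((hmemS n).1 hn) i))
    (by rwa [hS, ← Set.ncard_eq_toFinset_card _ hfin])
    (fun j hj => by
      rw [hfB j hj]
      exact ⟨hmin j hj, b.norm_coord_le_of_osc_le hσ hosc hj hi⟩)
    (fun j hjS hjB => by
      rw [hfO j hjS hjB]
      exact dyz i ((hmemB i).1 hi) j)
    a ha
  have hsum : (∑ j ∈ B, a j • (b.coord j y • b.vec j)) =
      b.comb B fun j => a j * b.coord j f := by
    refine Finset.sum_congr rfl fun j hj => ?_
    change _ = (a j * b.coord j f) • b.vec j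
    rw [hfB j hj, mul_smul]
  rw [hsum, ← ofReal_norm, ← ofReal_norm]
  calc _ ≤ ENNReal.ofReal (C * ‖f‖) := ENNReal.ofReal_le_ofReal hmain
    _ = ENNReal.ofReal C * ENNReal.ofReal ‖f‖ := ENNReal.ofReal_mul hC
    _ ≤ _ := by gcongr; exact le_max_right _ _

lemma IsCesaroBound.psi_lt_top {b : SeminormalizedBasis 𝕜 X} {L : ℝ} (hL : b.IsCesaroBound L)
    {t σ : ℝ} (ht : 0 ≤ t) (hσ : 0 ≤ σ) : b.Psi t σ⁻¹ < ⊤ := by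
  obtain ⟨C, hC, h⟩ := hL.exists_isBlockBound ht hσ
  exact (sInf_le (show _ ∈ {C | b.IsThresholdBound t σ⁻¹ C} from
    h.isThresholdBound hσ hC)).trans_lt
    (max_lt ENNReal.one_lt_top ENNReal.ofReal_lt_top)

/-- The threshold function is itself an admissible constant. -/
lemma enorm_le_psi_mul (b : SeminormalizedBasis 𝕜 X) {t s : ℝ} {u f : X}
    (h : ∀ C, b.IsThresholdBound t s C → ‖u‖ₑ ≤ C * ‖f‖ₑ) (hfin : b.Psi t s < ⊤) :
    ‖u‖ ≤ (b.Psi t s).toReal * ‖f‖ := by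
  have h1 : ‖u‖ₑ ≤ b.Psi t s * ‖f‖ₑ := by
    -- Division by `‖f‖ₑ` fails here; finiteness of the infimum provides some admissible constant,
    -- which forces `u = 0`.
    by_cases hf : ‖f‖ₑ = 0
    · have hne : {C : ℝ≥0∞ | b.IsThresholdBound t s C}.Nonempty := by
        by_contra hempty
        rw [Set.not_nonempty_iff_eq_empty] at hempty
        rw [Psi, hempty, sInf_empty] at hfin
        exact lt_irrefl _ hfin
      obtain ⟨C, hC⟩ := hne
      have := h C hC
      rw [hf, mul_zero] at this ⊢
      exact this
    · rw [← ENNReal.div_le_iff_le_mul (Or.inl hf) (Or.inl enorm_ne_top)]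
      exact le_sInf fun C hC => ENNReal.div_le_of_le_mul (h C hC)
  rwa [← ENNReal.ofReal_toReal hfin.ne, ← ofReal_norm, ← ofReal_norm,
    ← ENNReal.ofReal_mul ENNReal.toReal_nonneg,
    ENNReal.ofReal_le_ofReal_iff (by positivity)] at h1

/-! ### Uniform bound for the greedy sums -/

lemma IsGreedyOrdering.norm_coord_anti {b : SeminormalizedBasis 𝕜 X} {f : X} {k : ℕ → ℕ}
    (hk : b.IsGreedyOrdering f k) {m i j : ℕ} (hi : i ∈ (Finset.range m).image k)
    (hj : j ∉ (Finset.range m).image k) : ‖b.coord j f‖ ≤ ‖b.coord i f‖ :=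
  (hk m).2 i hi j hj

lemma disjoint_block {k : ℕ → ℕ} (hk : Function.Injective k) (N : ℕ) :
    Disjoint ((Finset.range N).image k) (block k N) := by
  rw [block, Finset.disjoint_image hk, Finset.disjoint_left]
  intro i hi hi'
  rw [Finset.mem_range] at hi
  rw [Finset.mem_Ico] at hi'
  omega

lemma image_range_union_block (k : ℕ → ℕ) (N : ℕ) :
    (Finset.range N).image k ∪ block k N = (Finset.range (2 * N)).image k := by
  rw [block, ← Finset.image_union]
  congr 1
  ext i
  simp only [Finset.mem_union, Finset.mem_range, Finset.mem_Ico]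
  omega

lemma card_block {k : ℕ → ℕ} (hk : Function.Injective k) (N : ℕ) : (block k N).card = N := by
  rw [block, Finset.card_image_of_injective _ hk, Nat.card_Ico]
  omega

lemma IsGreedyOrdering.norm_comb_block_le {b : SeminormalizedBasis 𝕜 X} {f : X} {k : ℕ → ℕ}
    (hk : b.IsGreedyOrdering f k) {σ : ℝ} (hσ : 0 ≤ σ) (hPsi : b.Psi 1 σ⁻¹ < ⊤) {N : ℕ}
    (hosc : b.osc f (block k N) ≤ ENNReal.ofReal σ) {a : ℕ → 𝕜}
    (ha : ∀ j ∈ block k N, ‖a j‖ ≤ 1) :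
    ‖b.comb (block k N) fun j => a j * b.coord j f‖ ≤ (b.Psi 1 σ⁻¹).toReal * ‖f‖ := by
  have hinj := hk.injective
  set Y := (Finset.range N).image k with hY
  set B := block k N with hB
  have hYB : Disjoint Y B := disjoint_block hinj N
  have hYBu : Y ∪ B = (Finset.range (2 * N)).image k := image_range_union_block k N
  -- A vanishing coefficient in a block of finite oscillation forces all of them to vanish.
  -- Otherwise the block is exactly the support of `y`, as the threshold inequality demands.
  by_cases hz : ∃ i ∈ B, b.coord i f = 0
  · obtain ⟨i, hi, hi0⟩ := hz
    rw [b.comb_eq_zero fun j hj => by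
      have := b.norm_coord_le_of_osc_le hσ hosc hj hi
      rw [hi0, norm_zero, mul_zero, norm_le_zero_iff] at this
      rw [this, mul_zero], norm_zero]
    positivity
  push Not at hz
  refine b.enorm_le_psi_mul (fun C hC => ?_) hPsi
  set x := b.comb Y fun j => b.coord j f with hx
  set y := b.comb B fun j => b.coord j f with hy
  set z := f - x - y with hzdef
  have hcx : ∀ j, b.coord j x = if j ∈ Y then b.coord j f else 0 := fun j => b.coord_comb _ _ _
  have hcy : ∀ j, b.coord j y = if j ∈ B then b.coord j f else 0 := fun j => b.coord_comb _ _ _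
  have hcz : ∀ j, b.coord j z = if j ∈ Y ∪ B then 0 else b.coord j f := fun j => by
    rw [hzdef, map_sub, map_sub, hcx, hcy]
    by_cases h1 : j ∈ Y
    · have h2 : j ∉ B := Finset.disjoint_left.1 hYB h1
      simp [h1, h2]
    · by_cases h2 : j ∈ B <;> simp [h1, h2]
  have hsx : ∀ j ∈ b.supp x, j ∈ Y := fun j hj => by
    by_contra hne
    exact hj (by rw [hcx, if_neg hne])
  have hsy : ∀ j ∈ b.supp y, j ∈ B := fun j hj => by
    by_contra hne
    exact hj (by rw [hcy, if_neg hne])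
  have hsz : ∀ j ∈ b.supp z, j ∉ Y ∪ B := fun j hj hmem => hj (by rw [hcz, if_pos hmem])
  have hsum : f = x + y + z := by rw [hzdef]; abel
  have hmain := hC.2 x y z B a
    (Set.disjoint_left.2 fun j hj hj' => Finset.disjoint_left.1 hYB (hsx j hj) (hsy j hj'))
    (Set.disjoint_left.2 fun j hj hj' => hsz j hj' (Finset.mem_union_left _ (hsx j hj)))
    (Set.disjoint_left.2 fun j hj hj' => hsz j hj' (Finset.mem_union_right _ (hsy j hj)))
    (fun i hi j => by
      rw [hcx i, if_pos (hsx i hi), hcy]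
      split_ifs with hj
      · exact hk.norm_coord_anti (hsx i hi) (Finset.disjoint_right.1 hYB hj)
      · simp)
    (fun i hi j => by
      rw [hcy i, if_pos (hsy i hi), hcz]
      split_ifs with hj
      · simp
      · rw [hYBu] at hj
        exact hk.norm_coord_anti (hYBu ▸ Finset.mem_union_right _ (hsy i hi)) hj)
    (by
      ext j
      refine ⟨fun hj => ?_, hsy j⟩
      change b.coord j y ≠ 0
      rw [hcy, if_pos (Finset.mem_coe.1 hj)]
      exact hz j hj)
    (Y.finite_toSet.subset hsx)
    (by
      rw [one_mul, card_block hinj]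
      have h1 := Set.ncard_le_ncard (s := b.supp x) hsx Y.finite_toSet
      rw [Set.ncard_coe_finset, (hk N).1] at h1
      exact_mod_cast h1)
    (by
      have : b.osc y B = b.osc f B := by
        have h1 : ∀ j ∈ B, b.coord j y = b.coord j f := fun j hj => by rw [hcy, if_pos hj]
        have h2 : (B.sup fun n => ‖b.coord n y‖ₑ) = B.sup fun n => ‖b.coord n f‖ₑ :=
          Finset.sup_congr rfl fun j hj => by rw [h1 j hj]
        have h3 : (B.inf fun n => ‖b.coord n y‖ₑ) = B.inf fun n => ‖b.coord n f‖ₑ :=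
          Finset.inf_congr rfl fun j hj => by rw [h1 j hj]
        have h4 : (∀ n ∈ B, b.coord n y = 0) ↔ ∀ n ∈ B, b.coord n f = 0 :=
          forall₂_congr fun j hj => by rw [h1 j hj]
        simp only [osc, h2, h3, h4]
      rw [this, inv_inv]
      exact hosc)
    ha
  rw [← hsum] at hmain
  refine le_of_eq_of_le ?_ hmain
  congr 1
  refine Finset.sum_congr rfl fun j hj => ?_
  rw [hcy, if_pos hj, mul_smul]

lemma IsVPQG.norm_greedySum_le {b : SeminormalizedBasis 𝕜 X} {K : ℝ} (hK : b.IsVPQG K) {f : X}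
    {k : ℕ → ℕ} (hk : b.IsGreedyOrdering f k) {σ : ℝ} (hσ : 0 ≤ σ) (hPsi : b.Psi 1 σ⁻¹ < ⊤)
    {N : ℕ} (hN : 0 < N) (hosc : b.osc f (block k N) ≤ ENNReal.ofReal σ) {j : ℕ} (hj : j ≤ N) :
    ‖b.greedySum k (N + j) f‖ ≤ (K + (b.Psi 1 σ⁻¹).toReal) * ‖f‖ := by
  have hinj := hk.injective
  have hN' : (N : 𝕜) ≠ 0 := by exact_mod_cast hN.ne'
  have hNR : (0 : ℝ) < N := by exact_mod_cast hN
  have hblock : block k N = (Finset.range N).image fun i => k (N + i) := by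
    ext n
    simp only [block, Finset.mem_image, Finset.mem_Ico, Finset.mem_range]
    constructor
    · rintro ⟨i, hi, rfl⟩
      exact ⟨i - N, by omega, by congr 1; omega⟩
    · rintro ⟨i, hi, rfl⟩
      exact ⟨N + i, by omega, rfl⟩
  have hinj' : Function.Injective fun i => k (N + i) := fun i i' h => by
    have := hinj h; omega
  -- The weights of `G_{N+j}` on the block minus those of the de la Vallée-Poussin sum: both lie in
  -- `[0, 1]`, so `|r i| ≤ 1`.
  let r : ℕ → ℝ := fun i => (if i < j then 1 else 0) - ((N : ℝ) - i) / N
  let a : ℕ → 𝕜 := fun n => ((r (Function.invFun (fun i => k (N + i)) n) : ℝ) : 𝕜)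
  have hak : ∀ i, a (k (N + i)) = (r i : 𝕜) := fun i => by
    have := Function.leftInverse_invFun hinj' i
    simp only [a]
    rw [this]
  have hr : ∀ i < N, |r i| ≤ 1 := fun i hi => by
    have hi' : (i : ℝ) ≤ N := by exact_mod_cast hi.le
    have h0 : (0 : ℝ) ≤ i := Nat.cast_nonneg i
    have h1 : 0 ≤ ((N : ℝ) - i) / N := div_nonneg (by linarith) hNR.le
    have h2 : ((N : ℝ) - i) / N ≤ 1 := (div_le_one hNR).2 (by linarith)
    simp only [r]
    rw [abs_le]
    split_ifs <;> constructor <;> linarith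
  have hmain := hk.norm_comb_block_le hσ hPsi hosc (a := a) fun n hn => by
    rw [hblock] at hn
    obtain ⟨i, hi, rfl⟩ := Finset.mem_image.1 hn
    rw [hak, RCLike.norm_ofReal]
    exact hr i (Finset.mem_range.1 hi)
  have hvp := hK.2 f k hk N hN
  have key : b.greedySum k (N + j) f =
      ((2 : 𝕜) • b.cesaroSum k (2 * N) f - b.cesaroSum k N f) +
        b.comb (block k N) fun n => a n * b.coord n f := by
    have h1 : b.greedySum k (N + j) f = b.greedySum k N f +
        ∑ i ∈ Finset.range N, (if i < j then (1 : 𝕜) else 0) •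
          (b.coord (k (N + i)) f • b.vec (k (N + i))) := by
      rw [greedySum, Finset.sum_range_add, greedySum]
      congr 1
      refine Finset.sum_subset_zero_on_sdiff (Finset.range_subset_range.2 hj) ?_ ?_
      · intro i hi
        rw [Finset.mem_sdiff, Finset.mem_range, Finset.mem_range] at hi
        rw [if_neg hi.2, zero_smul]
      · intro i hi
        rw [if_pos (Finset.mem_range.1 hi), one_smul]
    rw [vp_eq, two_mul, cumSum_add_sub, smul_add, smul_smul, inv_mul_cancel₀ hN', one_smul, h1,
      add_assoc, hblock, comb, Finset.sum_image hinj'.injOn, Finset.smul_sum,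
      ← Finset.sum_add_distrib]
    congr 1
    refine Finset.sum_congr rfl fun i _ => ?_
    rw [hak, mul_smul, smul_smul (N : 𝕜)⁻¹, ← add_smul]
    congr 1
    simp only [r]
    split_ifs <;> push_cast <;> ring
  rw [key]
  exact (norm_add_le _ _).trans (by linarith)

/-! ### Convergence -/

/-- Projections onto sets of largest coefficients ending within a block of bounded oscillation
are bounded. -/
lemma IsCesaroBound.exists_norm_comb_add_comb_le {b : SeminormalizedBasis 𝕜 X} {L : ℝ}
    (hL : b.IsCesaroBound L) {σ : ℝ} (hσ : 0 ≤ σ) :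
    ∃ C, 0 ≤ C ∧ ∀ (f : X) (S U V : Finset ℕ) (α : ℝ), 0 ≤ α → Disjoint S U → V ⊆ U →
      U.Nonempty → b.IsTop f S → (S.card : ℝ) ≤ 2 * U.card →
      (∀ j ∈ U, α ≤ ‖b.coord j f‖ ∧ ‖b.coord j f‖ ≤ σ * α) →
      (∀ j, j ∉ S → j ∉ U → ‖b.coord j f‖ ≤ α) →
      ‖b.comb S (fun j => b.coord j f) + b.comb V fun j => b.coord j f‖ ≤ C * ‖f‖ := by
  obtain ⟨C, hC, h⟩ := hL.exists_isBlockBound zero_le_two hσ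
  have hL0 : 0 ≤ L := zero_le_one.trans hL.1
  refine ⟨L * (2 * 2 + 1) + C, by positivity, ?_⟩
  intro f S U V α hα hSU hVU hUne hS hcard hU hout
  have hT : b.IsTop f (S ∪ U) := by
    intro n hn j hj
    rw [Finset.mem_union, not_or] at hj
    rcases Finset.mem_union.1 hn with hn | hn
    · exact hS n hn j hj.1
    · exact (hout j hj.1 hj.2).trans (hU n hn).1
  obtain ⟨g, hg0, hg1, hg⟩ := hL.exists_window hSU hS hT hUne hcard
  -- The window over `S` and `U` has weights `g` on `U`; correcting them to the indicator of `V` is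
  -- a multiplier on a block.
  let s : ℕ → ℝ := fun j => (if j ∈ V then 1 else 0) - g j
  have hs : ∀ j ∈ U, ‖((s j : ℝ) : 𝕜)‖ ≤ 1 := fun j hj => by
    have h0 := hg0 j hj
    have h1 := hg1 j hj
    rw [RCLike.norm_ofReal, abs_le]
    simp only [s]
    split_ifs <;> constructor <;> linarith
  have hblock := h f S U α hα hSU hS hcard hU hout (fun j => (s j : 𝕜)) hs
  have hV : b.comb V (fun j => b.coord j f) =
      b.comb U (fun j => (g j : 𝕜) * b.coord j f) + b.comb U fun j => (s j : 𝕜) * b.coord j f := by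
    rw [← comb_add, b.comb_congr (S := V)
      (c' := fun j => (g j : 𝕜) * b.coord j f + (s j : 𝕜) * b.coord j f) fun j hj => ?_,
      b.comb_subset hVU fun j _ hj => ?_]
    · simp [s, hj]
    · simp only [s, if_pos hj]
      push_cast
      ring
  rw [hV, ← add_assoc]
  exact (norm_add_le _ _).trans (by linarith)

/-- All the coefficients outside a sufficiently long initial segment of a greedy ordering are
small. -/
lemma IsGreedyOrdering.exists_norm_coord_lt {b : SeminormalizedBasis 𝕜 X} {f : X} {k : ℕ → ℕ}
    (hk : b.IsGreedyOrdering f k) {η : ℝ} (hη : 0 < η) :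
    ∃ m, ∀ j ∉ (Finset.range m).image k, ‖b.coord j f‖ < η := by
  obtain ⟨j, ⟨i, rfl⟩, hi⟩ := (Set.infinite_range_of_injective hk.injective).exists_notMem_finite
    (b.finite_le_norm_coord f hη)
  refine ⟨i + 1, fun j hj => ?_⟩
  refine (hk.norm_coord_anti (i := k i) ?_ hj).trans_lt (not_le.1 hi)
  exact Finset.mem_image_of_mem _ (Finset.self_mem_range_succ i)

lemma IsGreedyOrdering.coord_eq_zero {b : SeminormalizedBasis 𝕜 X} {f : X} {k : ℕ → ℕ}
    (hk : b.IsGreedyOrdering f k) {j : ℕ} (hj : j ∉ Set.range k) : b.coord j f = 0 := by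
  by_contra hne
  obtain ⟨m, hm⟩ := hk.exists_norm_coord_lt (norm_pos_iff.2 hne)
  refine lt_irrefl _ (hm j fun hmem => hj ?_)
  obtain ⟨i, -, rfl⟩ := Finset.mem_image.1 hmem
  exact ⟨i, rfl⟩

/-- For a finite combination `u` of the basis, the greedy sums of `f` within long blocks of
bounded oscillation are as close to `u` as `f` is, up to a constant. -/
lemma IsCesaroBound.exists_norm_greedySum_sub_le {b : SeminormalizedBasis 𝕜 X} {L : ℝ}
    (hL : b.IsCesaroBound L) {σ : ℝ} (hσ : 0 ≤ σ) :
    ∃ C, 0 ≤ C ∧ ∀ (f : X) (k : ℕ → ℕ), b.IsGreedyOrdering f k → ∀ (F : Finset ℕ) (c : ℕ → 𝕜),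
      ∃ N₀, ∀ N ≥ N₀, b.osc f (block k N) ≤ ENNReal.ofReal σ → ∀ j ≤ N,
        ‖b.greedySum k (N + j) f - b.comb F c‖ ≤ C * ‖f - b.comb F c‖ := by
  classical
  obtain ⟨C, hC, h⟩ := hL.exists_norm_comb_add_comb_le hσ
  refine ⟨C, hC, fun f k hk F c => ?_⟩
  have hinj := hk.injective
  set g := f - b.comb F c with hg
  have hgF : ∀ j ∉ F, b.coord j g = b.coord j f := fun j hj => by
    rw [hg, map_sub, coord_comb, if_neg hj, sub_zero]
  obtain ⟨η, hη, hηF⟩ : ∃ η > 0, ∀ j ∈ F, b.coord j g ≠ 0 → η ≤ ‖b.coord j g‖ := by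
    rcases (F.filter fun j => b.coord j g ≠ 0).eq_empty_or_nonempty with hF | hF
    · refine ⟨1, one_pos, fun j hj hne => ?_⟩
      have : j ∈ F.filter fun j => b.coord j g ≠ 0 := Finset.mem_filter.2 ⟨hj, hne⟩
      rw [hF] at this
      exact absurd this (Finset.notMem_empty j)
    · obtain ⟨i, hi, hmin⟩ := Finset.exists_min_image _ (fun j => ‖b.coord j g‖) hF
      exact ⟨_, norm_pos_iff.2 (Finset.mem_filter.1 hi).2, fun j hj hne =>
        hmin j (Finset.mem_filter.2 ⟨hj, hne⟩)⟩
  obtain ⟨m, hm⟩ := hk.exists_norm_coord_lt hη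
  let M := F.sup fun j => Function.invFun k j
  have hM : ∀ i, k i ∈ F → i ≤ M := fun i hi => by
    have h1 : Function.invFun k (k i) ≤ M := Finset.le_sup (f := fun j => Function.invFun k j) hi
    rwa [Function.leftInverse_invFun hinj] at h1
  -- For `N` this large, coefficients of `f` outside the first `N` terms are below `η`, all
  -- enumerated indices of `F` are among these terms, and `N + |F| ≤ 2N`.
  refine ⟨m + (M + 1) + F.card, fun N hN hosc j hj => ?_⟩
  set A := (Finset.range N).image k with hA
  set U := block k N with hU
  set V := (Finset.Ico N (N + j)).image k with hV
  have hAU : Disjoint A U := disjoint_block hinj N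
  have hVU : V ⊆ U := Finset.image_subset_image (Finset.Ico_subset_Ico_right (by omega))
  have hUF : Disjoint U F := Finset.disjoint_left.2 fun n hn hnF => by
    obtain ⟨i, hi, rfl⟩ := Finset.mem_image.1 hn
    have := hM i hnF
    rw [Finset.mem_Ico] at hi
    omega
  have hgU : ∀ n ∈ U, b.coord n g = b.coord n f := fun n hn =>
    hgF n (Finset.disjoint_left.1 hUF hn)
  have hAm : ∀ n ∉ A, ‖b.coord n f‖ < η := fun n hn => hm n fun hmem => hn
    (Finset.image_subset_image (Finset.range_subset_range.2 (by omega)) hmem)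
  have hFA : ∀ n ∈ F, n ∉ A → b.coord n f = 0 := fun n hn hnA => by
    refine hk.coord_eq_zero fun ⟨i, hi⟩ => hnA ?_
    subst hi
    exact Finset.mem_image_of_mem _ (Finset.mem_range.2 (by have := hM i hn; omega))
  -- On `F` only the nonzero coefficients of `g` are kept; they are at least `η`, so `S` is a top
  -- set of `g`. Replacing `f` by `g` may change the cardinality of the initial set, whence the
  -- bound `|S| ≤ 2 |U|` instead of `|S| = |U|`.
  let S := (A \ F) ∪ F.filter fun n => b.coord n g ≠ 0
  have hSAF : S ⊆ A ∪ F := fun n hn => by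
    rcases Finset.mem_union.1 hn with hn | hn
    · exact Finset.mem_union_left _ (Finset.mem_sdiff.1 hn).1
    · exact Finset.mem_union_right _ (Finset.mem_filter.1 hn).1
  have hnS : ∀ n ∉ S, (n ∈ F ∧ b.coord n g = 0) ∨ (n ∉ F ∧ n ∉ A) := fun n hn => by
    simp only [S, Finset.mem_union, Finset.mem_sdiff, Finset.mem_filter] at hn
    tauto
  have hSU : Disjoint S U := (Finset.disjoint_union_left.2 ⟨hAU, hUF.symm⟩).mono_left hSAF
  have hStop : b.IsTop g S := by
    intro n hn l hl
    rcases hnS l hl with ⟨-, hl0⟩ | ⟨hlF, hlA⟩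
    · rw [hl0, norm_zero]; exact norm_nonneg _
    · rw [hgF l hlF]
      rcases Finset.mem_union.1 hn with hn | hn
      · rw [Finset.mem_sdiff] at hn
        rw [hgF n hn.2]
        exact hk.norm_coord_anti hn.1 hlA
      · rw [Finset.mem_filter] at hn
        exact (hAm l hlA).le.trans (hηF n hn.1 hn.2)
  have hUne : U.Nonempty := Finset.card_pos.1 (by rw [hU, card_block hinj]; omega)
  obtain ⟨i, hi, hmin⟩ := U.exists_min_image (fun n => ‖b.coord n f‖) hUne
  have hmain := h g S U V ‖b.coord i f‖ (norm_nonneg _) hSU hVU hUne hStop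
    (by
      have h1 := (Finset.card_le_card hSAF).trans (Finset.card_union_le A F)
      rw [(hk N).1] at h1
      rw [hU, card_block hinj]
      exact_mod_cast (show S.card ≤ 2 * N by omega))
    (fun n hn => by
      rw [hgU n hn]
      exact ⟨hmin n hn, b.norm_coord_le_of_osc_le hσ hosc hn hi⟩)
    (fun n hn hnU => by
      rcases hnS n hn with ⟨-, hn0⟩ | ⟨hnF, hnA⟩
      · rw [hn0, norm_zero]; exact norm_nonneg _
      · rw [hgF n hnF]
        have hunion := image_range_union_block k N
        refine hk.norm_coord_anti (m := 2 * N) ?_ ?_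
        · rw [← hunion]; exact Finset.mem_union_right _ hi
        · rw [← hunion, Finset.mem_union, not_or]; exact ⟨hnA, hnU⟩)
  have hAV : A ∪ V = (Finset.range (N + j)).image k := by
    rw [hA, hV, ← Finset.image_union]
    congr 1
    ext n
    simp only [Finset.mem_union, Finset.mem_range, Finset.mem_Ico]
    omega
  have hSV : Disjoint S V := hSU.mono_right hVU
  have hsub : S ∪ V ⊆ (A ∪ V) ∪ F := by
    refine Finset.union_subset (hSAF.trans ?_) ?_
    · exact Finset.union_subset_union Finset.subset_union_left subset_rfl
    · exact Finset.subset_union_right.trans Finset.subset_union_left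
  -- Both sides are the sum of all terms of `g` over `A ∪ V ∪ F`: the omitted coefficients of `g`
  -- vanish, and `f` has zero coefficients on the part of `F` outside `A`.
  have key : b.comb S (fun n => b.coord n g) + b.comb V (fun n => b.coord n g) =
      b.greedySum k (N + j) f - b.comb F c := by
    rw [← b.comb_union hSV, b.comb_subset hsub fun n hn hnSV => ?_]
    · rw [b.comb_congr (c' := fun n => b.coord n f - if n ∈ F then c n else 0) fun n _ => by
        rw [hg, map_sub, coord_comb], comb_sub, b.greedySum_eq_comb hinj, ← hAV]
      congr 1
      · refine (b.comb_subset Finset.subset_union_left fun n hn hnAV => ?_).symm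
        exact hFA n ((Finset.mem_union.1 hn).resolve_left hnAV) fun hnA =>
          hnAV (Finset.mem_union_left _ hnA)
      · rw [← b.comb_subset (S := F) Finset.subset_union_right fun n _ hn => if_neg hn]
        exact b.comb_congr fun n hn => if_pos hn
    · rw [Finset.mem_union, not_or] at hnSV
      rcases hnS n hnSV.1 with ⟨-, hn0⟩ | ⟨hnF, hnA⟩
      · exact hn0
      · simp only [Finset.mem_union] at hn
        tauto
  rwa [key] at hmain

end SeminormalizedBasis


theorem mainTheorem10 {𝕜 X : Type*} [RCLike 𝕜] [NormedAddCommGroup X] [NormedSpace 𝕜 X]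
    [CompleteSpace X] (b : SeminormalizedBasis 𝕜 X) (K : ℝ) (hK : b.IsVPQG K)
    (A : Set ℕ) (hA : A.Nonempty) (n : ℕ → ℕ) (hn : StrictMonoOn n A) (hpos : ∀ l ∈ A, 0 < n l)
    (E : Set ℕ) (hE : E = {i : ℕ | ∃ l ∈ A, ∃ j : ℕ, j ≤ n l ∧ i = n l + j})
    (x : X) (k : ℕ → ℕ) (hk : b.IsGreedyOrdering x k)
    (M : ℝ≥0∞) (hM : M = ⨆ l ∈ A, b.osc x (SeminormalizedBasis.block k (n l)))
    (hMfin : M < ⊤) :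
    b.Psi 1 (1 / M.toReal) < ⊤ ∧
    (∀ i ∈ E, ‖b.greedySum k i x‖ ≤ (K + 2 * (b.Psi 1 (1 / M.toReal)).toReal) * ‖x‖) ∧
    (A.Infinite → Tendsto (fun i => b.greedySum k i x) (atTop ⊓ 𝓟 E) (𝓝 x)) := by
  obtain ⟨L, hL⟩ := hK.exists_isCesaroBound
  have hσ : 0 ≤ M.toReal := ENNReal.toReal_nonneg
  have hosc : ∀ l ∈ A, b.osc x (SeminormalizedBasis.block k (n l)) ≤ ENNReal.ofReal M.toReal := fun l hl => by
    rw [ENNReal.ofReal_toReal hMfin.ne, hM]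
    exact le_iSup₂_of_le l hl le_rfl
  have hPsi : b.Psi 1 M.toReal⁻¹ < ⊤ := hL.psi_lt_top zero_le_one hσ
  rw [one_div]
  refine ⟨hPsi, fun i hi => ?_, fun _ => ?_⟩
  · rw [hE] at hi
    obtain ⟨l, hl, j, hj, rfl⟩ := hi
    refine (hK.norm_greedySum_le hk hσ hPsi (hpos l hl) (hosc l hl) hj).trans ?_
    gcongr
    linarith [ENNReal.toReal_nonneg (a := b.Psi 1 M.toReal⁻¹)]
  · obtain ⟨C, hC, h⟩ := hL.exists_norm_greedySum_sub_le hσ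
    rw [Metric.tendsto_nhds]
    intro ε hε
    -- The two errors total at most `C + 1` times the distance from `x` to the finite combination.
    obtain ⟨F, c, hFc⟩ := b.exists_comb_near x (show 0 < ε / (C + 1) by positivity)
    obtain ⟨N₀, hN₀⟩ := h x k hk F c
    rw [eventually_inf_principal]
    -- An element of `E` is `n l + j ≤ 2 n l`, so `2 N₀ ≤ i` gives `N₀ ≤ n l`.
    filter_upwards [eventually_ge_atTop (2 * N₀)] with i hi hiE
    rw [hE] at hiE
    obtain ⟨l, hl, j, hj, rfl⟩ := hiE
    have h1 := hN₀ (n l) (by omega) (hosc l hl) j hj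
    rw [lt_div_iff₀ (by positivity)] at hFc
    rw [dist_eq_norm]
    calc ‖b.greedySum k (n l + j) x - x‖
        ≤ ‖b.greedySum k (n l + j) x - b.comb F c‖ + ‖b.comb F c - x‖ :=
          norm_sub_le_norm_sub_add_norm_sub _ _ _
      _ ≤ C * ‖x - b.comb F c‖ + ‖x - b.comb F c‖ := by
          rw [norm_sub_rev (b.comb F c) x]; gcongr
      _ < ε := by linarith
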